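/- Setting. Two firms sell products whose values $Z_1,Z_2\in\{0,1\}$ to a consumer satisfy $\mathbb P(Z_1=1)=\mathbb P(Z_2=1)=\tfrac12$ and $\mathbb P(Z_1=0,Z_2=1)=\mathbb P(Z_1=1,Z_2=0)=\omega$, where $0<\omega\le\tfrac25$. Simultaneously and without observing each other, the firms choose (possibly random) prices $p_1,p_2$ (production is costless), and the consumer chooses a fusion $F$ of the prior, i.e. a distribution on $[0,1]^2$ of the posterior mean $(x,y)$ of $(Z_1,Z_2)$ that some signal induces. At the posterior mean $(x,y)$ and prices $(p_1,p_2)$ she then buys from firm 1 if $x-p_1>y-p_2$ and from firm 2 if $x-p_1<y-p_2$ (ties are broken by an arbitrary measurable rule), and always buys from one of the two. Firms maximize expected revenue; the consumer maximizes $\int (u-\kappa c)\,dF$, where $\kappa>0$, $u(x,y)=\mathbb E\max\{x-p_1,\,y-p_2\}$, and $$c(x,y)=\varphi(x)+\varphi(1-x)+\varphi(y)+\varphi(1-y).$$ Here $\varphi:[0,1]\to(-\infty,\infty]$ is finite on $(0,1)$, $\varphi(\tfrac12)=0$, $|\varphi'(z)|\to\infty$ as $z\downarrow 0$ and as $z\uparrow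 1$, $c$ is strictly convex (where finite), $c$ is three times differentiable on $(0,1)^2$, and $c_{xxx}(x,y)\le 0$ for $x\le\tfrac12$. An equilibrium is a triple $(F,G_1,G_2)$ of a fusion and two price distributions each of which is optimal given the others. For $\lambda>0$ let $\Gamma_L(p)=\frac{p-\sqrt2\lambda}{\lambda+p}$ and $\Gamma_H(p)=\frac{(3+\sqrt2)\lambda-2p}{\lambda-p}$, let $\gamma_H=\Gamma_H'$, and let $\Gamma=\Gamma^{\lambda}$ be the distribution function equal to $0$ for $p\le\sqrt2\lambda$, to $\Gamma_L$ on $[\sqrt2\lambda,(1+\sqrt2)\lambda]$, to $\Gamma_H$ on $[(1+\sqrt2)\lambda,(2+\sqrt2)\lambda]$, and to $1$ for $p\ge(2+\sqrt2)\lambda$. For $\lambda \in (0,1)$ put $$\tau(\kappa,\lambda)=2\int_{\sqrt2\lambda}^{(1+\sqrt2)\lambda}\gamma_H(p+\lambda)\,\Gamma_L(p)\,dp-\kappa\, c_x\!\left(\tfrac{1-\lambda}2,\tfrac{1+\lambda}2\right)+\kappa\, c_y\!\left(\tfrac{1-\lambda}2,\tfrac{1+\lambda}2\right)-1 .$$ Theorem.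 For all such $\varphi$ and $\omega$ there are $0<\underline\kappa<\bar\kappa$ and a function $\lambda:[\underline\kappa,\infty)\to(0,1)$ such that: (i) for every $\kappa\ge\underline\kappa$ there is an equilibrium (for every tie-breaking rule) in which the consumer comparison shops with uniform two-point support, i.e. $F$ puts probability $\tfrac12$ on each of $\left(\tfrac{1-\lambda(\kappa)}2,\tfrac{1+\lambda(\kappa)}2\right)$ and $\left(\tfrac{1+\lambda(\kappa)}2,\tfrac{1-\lambda(\kappa)}2\right)$, and both firms draw their prices from $\Gamma^{\lambda(\kappa)}$; (ii) for every $\kappa\ge\bar\kappa$, $\lambda(\kappa)$ is the unique solution in $(0,1)$ of $\tau(\kappa,\lambda)=0$, and $\lambda$ is strictly decreasing on $[\bar\kappa,\infty)$; (iii) $\lambda(\kappa)=2\omega$ for every $\kappa\in[\underline\kappa,\bar\kappa]$. -/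

import Mathlib

open MeasureTheory ProbabilityTheory Filter Topology

noncomputable section

namespace ComparisonShopping

/-! ## The consumer's information: prior, fusions, cost -/

/-- The unit square of posterior values `(x, y)`. -/
def square : Set (ℝ × ℝ) := Set.Icc 0 1 ×ˢ Set.Icc 0 1

/-- The law of `(Z₁, Z₂)`: both marginals are uniform on `{0, 1}` and
`ℙ(Z₁ = 0, Z₂ = 1) = ℙ(Z₁ = 1, Z₂ = 0) = ω`. -/
def prior (ω : ℝ) : Measure (ℝ × ℝ) :=
  ENNReal.ofReal ω • Measure.dirac (0, 1) + ENNReal.ofReal ω • Measure.dirac (1, 0)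
    + ENNReal.ofReal (1 / 2 - ω) • Measure.dirac (1, 1)
    + ENNReal.ofReal (1 / 2 - ω) • Measure.dirac (0, 0)

/-- `F` is a fusion of the prior: the law of the posterior mean `q` of `(Z₁, Z₂)` after observing
some signal.  `K q` is the conditional law of `(Z₁, Z₂)` given that the posterior mean is `q`; its
mean is `q`, and averaging `K q` over `F` gives the prior back. -/
structure IsFusion (ω : ℝ) (F : Measure (ℝ × ℝ)) : Prop where
  prob : IsProbabilityMeasure F
  supported : ∀ᵐ q ∂F, q ∈ square
  split : ∃ K : Kernel (ℝ × ℝ) (ℝ × ℝ), IsMarkovKernel K ∧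
    F.bind K = prior ω ∧ ∀ᵐ q ∂F, ∫ z, z ∂(K q) = q

/-- `c(x, y) = φ(x) + φ(1 - x) + φ(y) + φ(1 - y)`; it may be `⊤` on the boundary of the square. -/
def cost (φ : ℝ → EReal) (q : ℝ × ℝ) : EReal :=
  φ q.1 + φ (1 - q.1) + φ q.2 + φ (1 - q.2)

/-- `c` as a real function of two variables (it is finite on the open square). -/
def costReal (φ : ℝ → EReal) (x y : ℝ) : ℝ := (cost φ (x, y)).toReal

/-- The assumptions on the cost functional. -/
structure IsCost (φ : ℝ → EReal) : Prop where
  ne_bot : ∀ z ∈ Set.Icc (0 : ℝ) 1, φ z ≠ ⊥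
  finite : ∀ z ∈ Set.Ioo (0 : ℝ) 1, φ z ≠ ⊤
  half : φ (1 / 2) = 0
  /-- `c` is strictly convex on its effective domain. -/
  strictConvex : StrictConvexOn ℝ {q | q ∈ square ∧ cost φ q ≠ ⊤} (fun q => (cost φ q).toReal)
  /-- `c` is three times differentiable on the open square.  As `c` is symmetric and is a function
  of `x` plus a function of `y`, this is a statement about its sections in `x`. -/
  thriceDiff : ∀ x ∈ Set.Ioo (0 : ℝ) 1, ∀ y ∈ Set.Ioo (0 : ℝ) 1, ∀ k < 3,
    DifferentiableAt ℝ (iteratedDeriv k (fun t => costReal φ t y)) x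
  /-- `c_xxx ≤ 0` where `x ≤ 1/2`.  (`c_xxx` is odd under `x ↦ 1 - x`.) -/
  third_nonpos : ∀ x ∈ Set.Ioc (0 : ℝ) (1 / 2), ∀ y ∈ Set.Ioo (0 : ℝ) 1,
    iteratedDeriv 3 (fun t => costReal φ t y) x ≤ 0
  slope_zero : Tendsto (fun z => |deriv (fun t => (φ t).toReal) z|) (𝓝[>] 0) atTop
  slope_one : Tendsto (fun z => |deriv (fun t => (φ t).toReal) z|) (𝓝[<] 1) atTop

/-- The cost is nonnegative on the square: `c` is convex, is invariant under
`(x, y) ↦ (1 - x, 1 - y)` and vanishes at the centre. -/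
theorem IsCost.nonneg {φ : ℝ → EReal} (h : IsCost φ) {q : ℝ × ℝ} (hq : q ∈ square) :
    0 ≤ cost φ q := by
  by_cases ht : cost φ q = ⊤
  · rw [ht]; exact le_top
  have hsym : cost φ (1 - q.1, 1 - q.2) = cost φ q := by
    simp only [cost, sub_sub_cancel]
    rw [add_comm (φ (1 - q.1)) (φ q.1), add_assoc, add_comm (φ (1 - q.2)) (φ q.2), ← add_assoc]
  obtain ⟨⟨h1, h2⟩, ⟨h3, h4⟩⟩ := hq
  have hq' : q ∈ square := ⟨⟨h1, h2⟩, ⟨h3, h4⟩⟩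
  have hr : ((1 - q.1, 1 - q.2) : ℝ × ℝ) ∈ square :=
    ⟨⟨by simpa using h2, by simpa using h1⟩, ⟨by simpa using h4, by simpa using h3⟩⟩
  have hq1 : q ∈ {q | q ∈ square ∧ cost φ q ≠ ⊤} := ⟨hq', ht⟩
  have hq2 : ((1 - q.1, 1 - q.2) : ℝ × ℝ) ∈ {q | q ∈ square ∧ cost φ q ≠ ⊤} :=
    ⟨hr, by rw [hsym]; exact ht⟩
  have hc := h.strictConvex.convexOn.2 hq1 hq2 (by norm_num : (0 : ℝ) ≤ 1 / 2)
    (by norm_num : (0 : ℝ) ≤ 1 / 2) (by norm_num)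
  have hmid : (1 / 2 : ℝ) • q + (1 / 2 : ℝ) • ((1 - q.1, 1 - q.2) : ℝ × ℝ) = (1 / 2, 1 / 2) := by
    ext <;> simp <;> ring
  have h0 : cost φ (1 / 2, 1 / 2) = 0 := by
    have : (1 : ℝ) - 1 / 2 = 1 / 2 := by norm_num
    simp only [cost, this, h.half, add_zero]
  simp only [hmid, hsym, h0, EReal.toReal_zero, smul_eq_mul] at hc
  have hnb : cost φ q ≠ ⊥ := by
    simp only [cost, ne_eq, EReal.add_eq_bot_iff, not_or]
    exact ⟨⟨⟨h.ne_bot _ ⟨h1, h2⟩, h.ne_bot _ hr.1⟩, h.ne_bot _ ⟨h3, h4⟩⟩, h.ne_bot _ hr.2⟩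
  rw [← EReal.coe_toReal ht hnb]
  exact_mod_cast (by linarith : (0 : ℝ) ≤ (cost φ q).toReal)

/-! ## The game -/

/-- How the consumer resolves ties `x - p₁ = y - p₂`: the probability of buying from firm 1, as a
function of the posterior and of the prices. -/
structure IsTieRule (tie : ℝ × ℝ → ℝ × ℝ → ℝ) : Prop where
  measurable : Measurable (Function.uncurry tie)
  mem : ∀ q p, tie q p ∈ Set.Icc (0 : ℝ) 1

/-- Probability that the consumer with posterior `q = (x, y)` who faces the prices `p = (p₁, p₂)`
buys from firm 1. She always buys from one of the firms. -/
def buysFirst (tie : ℝ × ℝ → ℝ × ℝ → ℝ) (q p : ℝ × ℝ) : ℝ :=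
  if q.2 - p.2 < q.1 - p.1 then 1 else if q.1 - p.1 < q.2 - p.2 then 0 else tie q p

/-- Expected profit of firm 1 (marginal cost is zero). -/
def profitOne (tie : ℝ × ℝ → ℝ × ℝ → ℝ) (F : Measure (ℝ × ℝ)) (G₁ G₂ : Measure ℝ) : ℝ :=
  ∫ s, s.2.1 * buysFirst tie s.1 s.2 ∂(F.prod (G₁.prod G₂))

/-- Expected profit of firm 2. -/
def profitTwo (tie : ℝ × ℝ → ℝ × ℝ → ℝ) (F : Measure (ℝ × ℝ)) (G₁ G₂ : Measure ℝ) : ℝ :=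
  ∫ s, s.2.2 * (1 - buysFirst tie s.1 s.2) ∂(F.prod (G₁.prod G₂))

/-- The consumer's reduced form utility `u(x, y)`, gross of the cost of information. -/
def utility (tie : ℝ × ℝ → ℝ × ℝ → ℝ) (G₁ G₂ : Measure ℝ) (q : ℝ × ℝ) : ℝ :=
  ∫ p, (buysFirst tie q p * (q.1 - p.1) + (1 - buysFirst tie q p) * (q.2 - p.2)) ∂(G₁.prod G₂)

/-- `∫ (u - κ c) dF`, which is `⊥` when the expected cost is infinite.  The cost is nonnegative on
the square (`IsCost.nonneg`), so `toENNReal` does not truncate anything there. -/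
def consumerPayoff (tie : ℝ × ℝ → ℝ × ℝ → ℝ) (φ : ℝ → EReal) (κ : ℝ) (F : Measure (ℝ × ℝ))
    (G₁ G₂ : Measure ℝ) : EReal :=
  ((∫ q, utility tie G₁ G₂ q ∂F : ℝ) : EReal)
    - (κ : EReal) * ((∫⁻ q, (cost φ q).toENNReal ∂F : ENNReal) : EReal)

/-- Equilibrium: the fusion `F` is optimal for the consumer given the firms' (mixed) pricing
strategies, and each firm's pricing strategy is optimal given the other's and the consumer's
(unobserved) learning `F`. Payoffs are linear in a firm's own strategy, so that it is enough to
consider deviations to a single price. -/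
structure IsEquilibrium (tie : ℝ × ℝ → ℝ × ℝ → ℝ) (φ : ℝ → EReal) (ω κ : ℝ)
    (F : Measure (ℝ × ℝ)) (G₁ G₂ : Measure ℝ) : Prop where
  prob_one : IsProbabilityMeasure G₁
  prob_two : IsProbabilityMeasure G₂
  /-- Prices have finite mean, so that all payoffs are well defined. -/
  integrable_one : Integrable (fun p : ℝ => p) G₁
  integrable_two : Integrable (fun p : ℝ => p) G₂
  fusion : IsFusion ω F
  consumer : ∀ F' : Measure (ℝ × ℝ), IsFusion ω F' →
    consumerPayoff tie φ κ F' G₁ G₂ ≤ consumerPayoff tie φ κ F G₁ G₂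
  firm_one : ∀ p : ℝ, profitOne tie F (Measure.dirac p) G₂ ≤ profitOne tie F G₁ G₂
  firm_two : ∀ p : ℝ, profitTwo tie F G₁ (Measure.dirac p) ≤ profitTwo tie F G₁ G₂

/-! ## The strategies of the theorem -/

/-- The consumer comparison shops with uniform two-point support, with parameter `l`. -/
def twoPoint (l : ℝ) : Measure (ℝ × ℝ) :=
  (2⁻¹ : ENNReal) • Measure.dirac ((1 - l) / 2, (1 + l) / 2)
    + (2⁻¹ : ENNReal) • Measure.dirac ((1 + l) / 2, (1 - l) / 2)

/-- The lower piece of the price distribution function. -/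
def gammaL (l p : ℝ) : ℝ := (p - √2 * l) / (l + p)

/-- The upper piece of the price distribution function. -/
def gammaH (l p : ℝ) : ℝ := ((3 + √2) * l - 2 * p) / (l - p)

/-- The distribution function of prices `Γ`, with support `[√2 l, (2 + √2) l]`. -/
def priceCDF (l p : ℝ) : ℝ :=
  if p ≤ √2 * l then 0
  else if p ≤ (1 + √2) * l then gammaL l p
  else if p ≤ (2 + √2) * l then gammaH l p
  else 1

/-- `P₁(z)`: the integral of `γ_H(p + z) Γ_L(p)` from `√2 l` to `(2 + √2) l - z`, where `γ_H` is
the density of `Γ_H`. -/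
def P₁ (l z : ℝ) : ℝ :=
  ∫ p in (√2 * l)..((2 + √2) * l - z), deriv (gammaH l) (p + z) * gammaL l p

/-- `c_x(x, y)`. -/
def costX (φ : ℝ → EReal) (x y : ℝ) : ℝ := deriv (fun t => costReal φ t y) x

/-- `c_y(x, y)`. -/
def costY (φ : ℝ → EReal) (x y : ℝ) : ℝ := deriv (fun t => costReal φ x t) y

/-- The left-hand side `τ(κ, l)` of the equation `τ(κ, l) = 0` that determines `l`. -/
def tau (φ : ℝ → EReal) (κ l : ℝ) : ℝ :=
  2 * P₁ l l - κ * costX φ ((1 - l) / 2) ((1 + l) / 2)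
    + κ * costY φ ((1 - l) / 2) ((1 + l) / 2) - 1

end ComparisonShopping

end

open ComparisonShopping

noncomputable section

namespace ComparisonShopping

/-! ## The price distribution at unit scale -/

/-! Scaling reduces the price law to l = 1.

Firms. `Γ` is built so that revenue against it is constant on its support and no larger elsewhere
(`revenue_one_eq`, `revenue_one_le`). It has no atoms, so ties have probability zero and the tie
rule is irrelevant.

Consumer. Against `Γ` her utility is (x + y)/2 plus a function of d = |x - y|. Of the fusion
constraint only E x = E y = 1/2 and E|x - y| ≤ 2ω are needed (`IsFusion.moments`). The optimality
proof is weak duality: a function (x + y)/2 + s d + const with s ≥ 0 that dominates u - κc bounds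
every payoff by 1/2 + 2ωs + const. The two-point fusion attains this bound when the function touches
u - κc at its two atoms and s = 0 or l = 2ω. Tangency at d = l forces s = `edge` - κ `margCost` l.

Domination is a comparison of two parabolas in t = d/l that agree to first order at t = 1. Since
c_xxx ≤ 0, marginal cost divided by d is nondecreasing, so c lies above a parabola in d
(`IsCost.cost_ge`). The function `gain` lies below one with second derivative `edge - edgeSlack`
(`gain_le`). Hence edge - edgeSlack ≤ κ margCost l ≤ edge suffices. As edgeSlack > 0, at l = 2ω this
is a nondegenerate interval of κ, namely [κlow, κbar]. Above κbar, l solves κ margCost l = edge,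
which is τ = 0 (`IsCost.tau_eq`).

The hard point is `gain_le`. The law of p₁ - p₂ must lie above its chord on [0, 1] and below a line
of slope less than `edge` beyond 1, although the density of `Γ` jumps up in the middle of the
support. The remedy is to pair the rival prices p and p + 1: the kinks of Γ(p + t) and Γ(p + 1 + t)
occur at the same t = 1 + √2 - p, one upward and one downward, and with the density weights the
downward kink wins, with room to spare (`slopeHigh_add_le`, `le_pairCDF`). -/

/-- The density of `Γ¹` at `p ∈ [√2, 1 + √2]`. -/
def lowDensity (p : ℝ) : ℝ := (1 + √2) / (p + 1) ^ 2

/-- The density of `Γ¹` at `p + 1`, for `p ∈ [√2, 1 + √2]`. -/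
def highDensity (p : ℝ) : ℝ := (1 + √2) / p ^ 2

theorem sqrt_two_sq : √2 * √2 = (2 : ℝ) := Real.mul_self_sqrt (by norm_num)

theorem sqrt_two_gt : (1.4142 : ℝ) < √2 := by
  rw [Real.lt_sqrt (by norm_num)]; norm_num

theorem sqrt_two_lt : √2 < (1.4143 : ℝ) := by
  rw [Real.sqrt_lt' (by norm_num)]; norm_num

theorem priceCDF_one_bot {p : ℝ} (h : p ≤ √2) : priceCDF 1 p = 0 := by
  simp [priceCDF, h]

theorem priceCDF_one_low {p : ℝ} (h₁ : √2 ≤ p) (h₂ : p ≤ 1 + √2) :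
    priceCDF 1 p = 1 - (1 + √2) / (p + 1) := by
  have := sqrt_two_gt
  have hp : p + 1 ≠ 0 := by linarith
  rcases h₁.eq_or_lt with rfl | h
  · rw [priceCDF_one_bot le_rfl, add_comm (1 : ℝ), div_self hp]; ring
  · rw [priceCDF, if_neg (by linarith), if_pos (by linarith), gammaL]
    have hp' : 1 + p ≠ 0 := by linarith
    field_simp
    ring

theorem priceCDF_one_high {p : ℝ} (h₁ : 1 + √2 ≤ p) (h₂ : p ≤ 2 + √2) :
    priceCDF 1 p = 2 - (1 + √2) / (p - 1) := by
  have h3 := sqrt_two_gt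
  have hp : p - 1 ≠ 0 := by linarith
  have hp' : 1 - p ≠ 0 := by linarith
  rcases h₁.eq_or_lt with rfl | h
  · rw [priceCDF_one_low (by linarith) le_rfl]
    have : (√2 : ℝ) ≠ 0 := by linarith
    have : (1 + √2 + 1 : ℝ) ≠ 0 := by linarith
    have h4 := sqrt_two_sq
    simp only [add_sub_cancel_left]
    field_simp
    nlinarith
  · rw [priceCDF, if_neg (by linarith), if_neg (by linarith), if_pos (by linarith), gammaH,
      ← neg_sub p 1, div_neg]
    field_simp
    ring

theorem priceCDF_one_top {p : ℝ} (h : 2 + √2 ≤ p) : priceCDF 1 p = 1 := by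
  have h3 := sqrt_two_gt
  rcases h.eq_or_lt with rfl | h
  · rw [priceCDF_one_high (by linarith) le_rfl, show 2 + √2 - 1 = 1 + √2 by ring,
      div_self (by linarith)]
    norm_num
  · rw [priceCDF, if_neg (by linarith), if_neg (by linarith), if_neg (by linarith)]

/-- The projection of the line to `[√2, 1 + √2]`. -/
def clampPrice (p : ℝ) : ℝ := max √2 (min p (1 + √2))

theorem sqrt_two_le_clampPrice (p : ℝ) : √2 ≤ clampPrice p := le_max_left _ _

theorem clampPrice_le (p : ℝ) : clampPrice p ≤ 1 + √2 :=
  max_le (by linarith) (min_le_right _ _)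

theorem clampPrice_mono : Monotone clampPrice := fun _ _ h =>
  max_le_max le_rfl (min_le_min h le_rfl)

theorem clampPrice_of_le {p : ℝ} (h : p ≤ √2) : clampPrice p = √2 :=
  max_eq_left ((min_le_left _ _).trans h)

theorem clampPrice_of_ge {p : ℝ} (h : 1 + √2 ≤ p) : clampPrice p = 1 + √2 := by
  rw [clampPrice, min_eq_right h, max_eq_right (by linarith)]

theorem clampPrice_of_mem {p : ℝ} (h₁ : √2 ≤ p) (h₂ : p ≤ 1 + √2) : clampPrice p = p := by
  rw [clampPrice, min_eq_left h₂, max_eq_right h₁]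

theorem one_add_sqrt_two_div_sqrt_two : (1 + √2) / √2 = 1 + √2 / 2 := by
  have := sqrt_two_gt
  have h4 := sqrt_two_sq
  rw [div_eq_iff (by linarith)]; nlinarith

theorem one_add_sqrt_two_div : (1 + √2) / (1 + √2 + 1) = √2 / 2 := by
  have := sqrt_two_gt
  have h4 := sqrt_two_sq
  rw [div_eq_iff (by linarith)]; nlinarith

/-- Writing the four-case function as a sum of two clamped monotone pieces gives continuity,
monotonicity and the mass of half-lines with no further case analysis. -/
theorem priceCDF_one_eq (p : ℝ) : priceCDF 1 p =
    (1 - (1 + √2) / (clampPrice p + 1)) +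
      ((1 + √2) / √2 - (1 + √2) / clampPrice (p - 1)) := by
  have h3 := sqrt_two_gt
  rcases le_total p √2 with h | h
  · rw [priceCDF_one_bot h, clampPrice_of_le h, clampPrice_of_le (by linarith), add_comm √2,
      div_self (by linarith)]; ring
  rcases le_total p (1 + √2) with h' | h'
  · rw [priceCDF_one_low h h', clampPrice_of_mem h h', clampPrice_of_le (by linarith)]; ring
  rw [clampPrice_of_ge h', one_add_sqrt_two_div, one_add_sqrt_two_div_sqrt_two]
  rcases le_total p (2 + √2) with h'' | h''
  · rw [priceCDF_one_high h' h'', clampPrice_of_mem (by linarith) (by linarith)]; ring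
  · rw [priceCDF_one_top h'', clampPrice_of_ge (by linarith), div_self (by linarith)]; ring

theorem continuous_clampPrice : Continuous clampPrice := by unfold clampPrice; fun_prop

theorem continuous_priceCDF_one : Continuous (priceCDF 1) := by
  have h3 := sqrt_two_gt
  have h := continuous_clampPrice
  have h' : Continuous fun p => clampPrice (p - 1) := h.comp (by fun_prop)
  rw [show priceCDF 1 = _ from funext priceCDF_one_eq]
  refine Continuous.add (continuous_const.sub (continuous_const.div (by fun_prop) fun p => ?_))
    (continuous_const.sub (continuous_const.div h' fun p => ?_))
  · linarith [sqrt_two_le_clampPrice p]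
  · linarith [sqrt_two_le_clampPrice (p - 1)]

theorem priceCDF_one_mono : Monotone (priceCDF 1) := by
  intro p q h
  have h3 := sqrt_two_gt
  have h1 := clampPrice_mono h
  have h2 := clampPrice_mono (sub_le_sub_right h 1)
  have h4 := sqrt_two_le_clampPrice p
  have h5 := sqrt_two_le_clampPrice (p - 1)
  rw [priceCDF_one_eq, priceCDF_one_eq]
  have h6 : 0 < clampPrice p + 1 := by linarith
  have h7 : 0 < clampPrice (p - 1) := by linarith
  gcongr

theorem priceCDF_one_nonneg (p : ℝ) : 0 ≤ priceCDF 1 p := by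
  rw [← priceCDF_one_bot (min_le_left √2 p)]
  exact priceCDF_one_mono (min_le_right _ _)

theorem priceCDF_one_le_one (p : ℝ) : priceCDF 1 p ≤ 1 := by
  exact (priceCDF_one_mono (le_max_right (2 + √2) p)).trans_eq
    (priceCDF_one_top (le_max_left _ _))

theorem priceCDF_eq_div {l : ℝ} (hl : 0 < l) (p : ℝ) : priceCDF l p = priceCDF 1 (p / l) := by
  have hL : gammaL l p = gammaL 1 (p / l) := by
    rw [gammaL, gammaL, mul_one, ← mul_div_mul_right (p / l - √2) (1 + p / l) hl.ne', sub_mul,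
      add_mul, div_mul_cancel₀ _ hl.ne', one_mul]
  have hH : gammaH l p = gammaH 1 (p / l) := by
    rw [gammaH, gammaH, mul_one, ← mul_div_mul_right (3 + √2 - 2 * (p / l)) (1 - p / l) hl.ne',
      sub_mul, sub_mul, mul_assoc, div_mul_cancel₀ _ hl.ne', one_mul]
  simp only [priceCDF, div_le_iff₀ hl, mul_one, hL, hH]

/-! ## The distribution function along a pair of prices -/

/-- The contribution of the pair of prices `p`, `p + 1` to the density in `t` of `p₁ - p₂ ≤ t`. -/
def pairCDF (p t : ℝ) : ℝ :=
  lowDensity p * priceCDF 1 (p + t) + highDensity p * priceCDF 1 (p + 1 + t)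

/-- The second-order slack of `pairCDF`. -/
def pairSlack (p : ℝ) : ℝ := (1 + √2 - p) * (p - √2) / 50

/-- A function above its chords on [0, t] and [t, 1], with slopes dropping by at least c at t, is
above the chord on [0, 1]. The gap is at least c r (1 - t) to the left of t and c t (1 - r) to the
right; both exceed the symmetric product, which is convenient to integrate. -/
theorem concave_interp {f₀ f₁ f r t s₁ s₂ c : ℝ} (hr : r ∈ Set.Icc (0 : ℝ) 1)
    (ht : t ∈ Set.Icc (0 : ℝ) 1) (h₁₂ : c ≤ s₁ - s₂) (hc : 0 ≤ c)
    (htot : f₁ - f₀ = s₁ * t + s₂ * (1 - t))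
    (h₁ : r ≤ t → f₀ + s₁ * r ≤ f) (h₂ : t ≤ r → f₁ - s₂ * (1 - r) ≤ f) :
    (1 - r) * f₀ + r * f₁ + c * t * (1 - t) * r * (1 - r) ≤ f := by
  obtain ⟨hr0, hr1⟩ := hr
  obtain ⟨ht0, ht1⟩ := ht
  rcases le_total r t with h | h
  · have e : r * (1 - t) * c ≤ r * (1 - t) * (s₁ - s₂) := by gcongr
    have e2 : c * t * (1 - t) * r * (1 - r) ≤ r * (1 - t) * c := by
      have h0 : 0 ≤ r * (1 - t) * c := by have : 0 ≤ 1 - t := by linarith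
                                          positivity
      have : t * (1 - r) ≤ 1 := by nlinarith
      nlinarith
    have := h₁ h
    have e3 : (1 - r) * f₀ + r * f₁ = f₀ + r * (s₁ * t + s₂ * (1 - t)) := by rw [← htot]; ring
    nlinarith
  · have e : (1 - r) * t * c ≤ (1 - r) * t * (s₁ - s₂) := by gcongr
    have e2 : c * t * (1 - t) * r * (1 - r) ≤ (1 - r) * t * c := by
      have h0 : 0 ≤ (1 - r) * t * c := by have : 0 ≤ 1 - r := by linarith
                                          positivity
      have : (1 - t) * r ≤ 1 := by nlinarith
      nlinarith
    have := h₂ h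
    have e3 : (1 - r) * f₀ + r * f₁ = f₁ - (1 - r) * (s₁ * t + s₂ * (1 - t)) := by
      rw [← htot]; ring
    nlinarith

theorem pairCDF_zero {p : ℝ} (h₁ : √2 ≤ p) (h₂ : p ≤ 1 + √2) : pairCDF p 0 =
    lowDensity p * (1 - (1 + √2) / (p + 1)) + highDensity p * (2 - (1 + √2) / p) := by
  rw [pairCDF, add_zero, add_zero, priceCDF_one_low h₁ h₂,
    priceCDF_one_high (by linarith) (by linarith), add_sub_cancel_right]

theorem pairCDF_one {p : ℝ} (h₁ : √2 ≤ p) (h₂ : p ≤ 1 + √2) : pairCDF p 1 =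
    lowDensity p * (2 - (1 + √2) / p) + highDensity p := by
  rw [pairCDF, priceCDF_one_high (by linarith) (by linarith), priceCDF_one_top (by linarith),
    add_sub_cancel_right, mul_one]

theorem lowDensity_pos {p : ℝ} (h₁ : √2 ≤ p) : 0 < lowDensity p := by
  have := sqrt_two_gt
  have : 0 < p + 1 := by linarith
  unfold lowDensity; positivity

theorem highDensity_pos {p : ℝ} (h₁ : √2 ≤ p) : 0 < highDensity p := by
  have := sqrt_two_gt
  have : 0 < p := by linarith
  unfold highDensity; positivity

/-- The average slope of `pairCDF p` on `[0, 1 + √2 - p]`. -/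
def slopeLow (p : ℝ) : ℝ := lowDensity p * (√2 / 2) / (p + 1) + highDensity p / p

/-- The average slope of `pairCDF p` on `[1 + √2 - p, 1]`. -/
def slopeHigh (p : ℝ) : ℝ := lowDensity p * highDensity p * p * (√2 / 2)

theorem pairCDF_one_sub_zero {p : ℝ} (h₁ : √2 ≤ p) (h₂ : p ≤ 1 + √2) :
    pairCDF p 1 - pairCDF p 0 =
      slopeLow p * (1 + √2 - p) + slopeHigh p * (1 - (1 + √2 - p)) := by
  have h3 := sqrt_two_gt
  have h4 := sqrt_two_sq
  have hp : p ≠ 0 := by linarith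
  have hp1 : p + 1 ≠ 0 := by linarith
  rw [pairCDF_zero h₁ h₂, pairCDF_one h₁ h₂, slopeLow, slopeHigh]
  have e1 : highDensity p * p * (√2 / 2) * (1 - (1 + √2 - p)) =
      1 + √2 / 2 - (1 + √2) / p := by
    rw [highDensity]; field_simp; nlinarith
  have e2 : √2 / 2 / (p + 1) * (1 + √2 - p) + √2 / 2 = (1 + √2) / (p + 1) := by
    field_simp; nlinarith
  have e3 : (1 + √2 - p) / p = (1 + √2) / p - 1 := by field_simp
  linear_combination (-lowDensity p) * e1 - lowDensity p * e2 - highDensity p * e3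

/-- This is where the pairing pays off: the downward kink outweighs the upward one uniformly in p.
The first summand of `slopeLow` is not needed and is dropped. -/
theorem slopeHigh_add_le {p : ℝ} (h₁ : √2 ≤ p) (h₂ : p ≤ 1 + √2) :
    1 / 50 ≤ slopeLow p - slopeHigh p := by
  have h3 := sqrt_two_gt
  have h3' := sqrt_two_lt
  have h4 := sqrt_two_sq
  have hp : 0 < p := by linarith
  have hp1 : 0 < p + 1 := by linarith
  have hA := lowDensity_pos h₁
  have e0 : 0 ≤ lowDensity p * (√2 / 2) / (p + 1) := by positivity
  have e1 : highDensity p / p - slopeHigh p =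
      (1 + √2) * ((p + 1) ^ 2 - (1 + √2 / 2) * p ^ 2) / (p ^ 3 * (p + 1) ^ 2) := by
    rw [slopeHigh, highDensity, lowDensity]; field_simp
    linear_combination (-p ^ 2) * h4
  -- Equivalent to p ≤ 1/(√2 - 1) = 1 + √2, the right end of the range of p.
  have e2 : √2 * p ≤ p + 1 := by nlinarith
  have e3 : 2 * p ^ 2 ≤ (p + 1) ^ 2 := by nlinarith [mul_nonneg hp.le (sub_nonneg.2 h₁)]
  -- The constant is not sharp: by `e7` the quotient is at least (√2/2) / (p (p + 1)²), and p (p +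
  -- 1)² is below 28.2 at the right end.
  have e4 : 1 / 50 ≤ (1 + √2) * ((p + 1) ^ 2 - (1 + √2 / 2) * p ^ 2) / (p ^ 3 * (p + 1) ^ 2) := by
    rw [div_le_div_iff₀ (by norm_num) (by positivity)]
    have e5 : (1 - √2 / 2) * p ^ 2 ≤ (p + 1) ^ 2 - (1 + √2 / 2) * p ^ 2 := by nlinarith
    have e6 : (1 + √2) * ((1 - √2 / 2) * p ^ 2) = √2 / 2 * p ^ 2 := by
      linear_combination (-p ^ 2 / 2) * h4
    have e7 : √2 / 2 * p ^ 2 ≤ (1 + √2) * ((p + 1) ^ 2 - (1 + √2 / 2) * p ^ 2) := by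
      rw [← e6]; gcongr
    have e8 : p * (p + 1) ^ 2 ≤ 2.4143 * 3.4143 ^ 2 := by gcongr <;> linarith
    have e9 : p ^ 2 * (p * (p + 1) ^ 2) ≤ p ^ 2 * (2.4143 * 3.4143 ^ 2) := by gcongr
    nlinarith
  rw [slopeLow]; linarith

/-- Each branch of `Γ` is concave, so `pairCDF p` lies above its chords on either side of the common
kink t = 1 + √2 - p. With c = 1/50, the gap c t (1 - t) in `concave_interp` is `pairSlack p`. -/
theorem le_pairCDF {p r : ℝ} (h₁ : √2 ≤ p) (h₂ : p ≤ 1 + √2) (hr : r ∈ Set.Icc (0 : ℝ) 1) :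
    (1 - r) * pairCDF p 0 + r * pairCDF p 1 + pairSlack p * r * (1 - r) ≤ pairCDF p r := by
  have h3 := sqrt_two_gt
  have h4 := sqrt_two_sq
  have hp : 0 < p := by linarith
  have hp1 : 0 < p + 1 := by linarith
  have hA := lowDensity_pos h₁
  have hB := highDensity_pos h₁
  have hr' := hr
  obtain ⟨hr0, hr1⟩ := hr'
  have key := concave_interp (f₀ := pairCDF p 0) (f₁ := pairCDF p 1) (f := pairCDF p r)
    (t := 1 + √2 - p) hr ⟨by linarith, by linarith⟩ (slopeHigh_add_le h₁ h₂) (by norm_num)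
    (pairCDF_one_sub_zero h₁ h₂) ?_ ?_
  · have : pairSlack p * r * (1 - r) =
        1 / 50 * (1 + √2 - p) * (1 - (1 + √2 - p)) * r * (1 - r) := by rw [pairSlack]; ring
    rw [this]; exact key
  · intro hrt
    rw [pairCDF_zero h₁ h₂, pairCDF, priceCDF_one_low (by linarith) (by linarith),
      priceCDF_one_high (by linarith) (by linarith), slopeLow]
    -- Chord bounds: the reciprocal increments have a factor p + r + 1 or p + r in the denominator,
    -- which is replaced by its value at the kink, where p + r = 1 + √2.
    have e1 : (1 + √2) / (p + r + 1) ≤ (1 + √2) / (p + 1) - √2 / 2 / (p + 1) * r := by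
      have : √2 / 2 / (p + 1) * r = (1 + √2) * r / ((p + 1) * (1 + √2 + 1)) := by
        rw [← one_add_sqrt_two_div]
        field_simp
      have e : (1 + √2) / (p + 1) - (1 + √2) / (p + r + 1) =
          (1 + √2) * r / ((p + 1) * (p + r + 1)) := by
        have : p + r + 1 ≠ 0 := by linarith
        field_simp; ring
      have : (1 + √2) * r / ((p + 1) * (1 + √2 + 1)) ≤ (1 + √2) * r / ((p + 1) * (p + r + 1)) :=
        div_le_div_of_nonneg_left (by positivity) (by positivity)
          (mul_le_mul_of_nonneg_left (by linarith) hp1.le)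
      linarith
    have e2 : (1 + √2) / (p + 1 + r - 1) ≤ (1 + √2) / p - r / p := by
      have e : (1 + √2) / p - (1 + √2) / (p + 1 + r - 1) =
          (1 + √2) * r / (p * (p + r)) := by
        have : p + r ≠ 0 := by linarith
        rw [show p + 1 + r - 1 = p + r by ring]
        field_simp; ring
      have : (1 + √2) * r / (p * (1 + √2)) ≤ (1 + √2) * r / (p * (p + r)) := by
        exact div_le_div_of_nonneg_left (by positivity) (by positivity)
          (mul_le_mul_of_nonneg_left (by linarith) hp.le)
      have : (1 + √2) * r / (p * (1 + √2)) = r / p := by field_simp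
      linarith
    have e3 := mul_le_mul_of_nonneg_left e1 hA.le
    have e4 := mul_le_mul_of_nonneg_left e2 hB.le
    have e5 : (lowDensity p * (√2 / 2) / (p + 1) + highDensity p / p) * r =
        lowDensity p * (√2 / 2 / (p + 1) * r) + highDensity p * (r / p) := by ring
    linarith
  · intro hrt
    rw [pairCDF_one h₁ h₂, pairCDF, priceCDF_one_high (by linarith) (by linarith),
      priceCDF_one_top (by linarith), slopeHigh]
    have hq : 0 < p + r - 1 := by linarith
    -- Here the denominator is replaced by its least value, p + r - 1 = √2, attained at the kink.
    have e1 : (1 + √2) / (p + r - 1) ≤ (1 + √2) / p + highDensity p * p * (√2 / 2) * (1 - r) := by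
      have e : (1 + √2) / (p + r - 1) - (1 + √2) / p =
          (1 + √2) * (1 - r) / (p * (p + r - 1)) := by
        field_simp; ring
      have : (1 + √2) * (1 - r) / (p * (p + r - 1)) ≤ (1 + √2) * (1 - r) / (p * √2) := by
        have : 0 ≤ 1 - r := by linarith
        gcongr; linarith
      have : (1 + √2) * (1 - r) / (p * √2) = highDensity p * p * (√2 / 2) * (1 - r) := by
        rw [highDensity]; field_simp
        linear_combination (-(1 - r)) * h4
      linarith
    have e3 := mul_le_mul_of_nonneg_left e1 hA.le
    linarith

/-- Beyond r = 1 the term at p + 1 + r is saturated, and the other follows the upper branch, which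
lies below its tangent at p + 1 even after it is capped at 1. -/
theorem pairCDF_le {p r : ℝ} (h₁ : √2 ≤ p) (h₂ : p ≤ 1 + √2) (hr : 1 ≤ r) :
    pairCDF p r ≤ pairCDF p 1 + lowDensity p * highDensity p * (r - 1) := by
  have h3 := sqrt_two_gt
  have hp : 0 < p := by linarith
  have hA := lowDensity_pos h₁
  have key : priceCDF 1 (p + r) ≤ 2 - (1 + √2) / p + highDensity p * (r - 1) := by
    have e : (1 + √2) / p - highDensity p * (r - 1) ≤ (1 + √2) / (p + r - 1) := by
      have hq : 0 < p + r - 1 := by linarith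
      have e1 : (1 + √2) / p - (1 + √2) / (p + r - 1) =
          (1 + √2) * (r - 1) / (p * (p + r - 1)) := by
        field_simp; ring
      have : (1 + √2) * (r - 1) / (p * (p + r - 1)) ≤ (1 + √2) * (r - 1) / (p * p) := by
        have : 0 ≤ r - 1 := by linarith
        gcongr; linarith
      have : (1 + √2) * (r - 1) / (p * p) = highDensity p * (r - 1) := by
        rw [highDensity]; field_simp
      linarith
    rcases le_total (p + r) (2 + √2) with h | h
    · rw [priceCDF_one_high (by linarith) h]; linarith
    · rw [priceCDF_one_top h]
      have : (1 + √2) / (p + r - 1) ≤ 1 := by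
        rw [div_le_one (by linarith)]; linarith
      linarith
  rw [pairCDF_one h₁ h₂, pairCDF, priceCDF_one_top (by linarith : 2 + √2 ≤ p + 1 + r)]
  nlinarith

theorem pairSlack_nonneg {p : ℝ} (h₁ : √2 ≤ p) (h₂ : p ≤ 1 + √2) : 0 ≤ pairSlack p := by
  have := mul_nonneg (sub_nonneg.2 h₂) (sub_nonneg.2 h₁)
  unfold pairSlack; positivity

/-- The tangent slope at 1 is at most `slopeHigh p`, while the chord slope on [0, 1] exceeds
`slopeHigh p` by at least (1 + √2 - p)/50, which covers the slack. -/
theorem density_mul_le {p : ℝ} (h₁ : √2 ≤ p) (h₂ : p ≤ 1 + √2) :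
    lowDensity p * highDensity p ≤ pairCDF p 1 - pairCDF p 0 - pairSlack p / 3 := by
  have h4 := sqrt_two_sq
  have h3 := sqrt_two_gt
  have hAB := mul_pos (lowDensity_pos h₁) (highDensity_pos h₁)
  have hs := slopeHigh_add_le h₁ h₂
  have e1 : lowDensity p * highDensity p ≤ slopeHigh p := by
    have : 1 ≤ p * (√2 / 2) := by nlinarith
    rw [slopeHigh, mul_assoc _ p]; nlinarith
  have e2 : pairSlack p / 3 ≤ (1 + √2 - p) / 50 := by
    rw [pairSlack]
    nlinarith [mul_nonneg (sub_nonneg.2 h₂) (sub_nonneg.2 h₂)]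
  rw [pairCDF_one_sub_zero h₁ h₂]
  nlinarith

/-! ## The consumer's gain from comparing offers -/

/-- The antiderivative of `Γ¹` that vanishes at `0`. -/
def cumCDF (z : ℝ) : ℝ := ∫ x in (0 : ℝ)..z, priceCDF 1 x

theorem hasDerivAt_cumCDF (z : ℝ) : HasDerivAt cumCDF (priceCDF 1 z) z :=
  intervalIntegral.integral_hasDerivAt_right (continuous_priceCDF_one.intervalIntegrable _ _)
    continuous_priceCDF_one.aestronglyMeasurable.stronglyMeasurableAtFilter
    continuous_priceCDF_one.continuousAt

theorem continuous_cumCDF : Continuous cumCDF :=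
  continuous_iff_continuousAt.2 fun z => (hasDerivAt_cumCDF z).continuousAt

/-- The antiderivative of `pairCDF` in its second argument. -/
def pairGain (p t : ℝ) : ℝ :=
  lowDensity p * cumCDF (p + t) + highDensity p * cumCDF (p + 1 + t)

theorem hasDerivAt_pairGain (p t : ℝ) : HasDerivAt (pairGain p) (pairCDF p t) t := by
  have h1 := (hasDerivAt_cumCDF (p + t)).comp_const_add p t
  have h2 := (hasDerivAt_cumCDF (p + 1 + t)).comp_const_add (p + 1) t
  exact (h1.const_mul _).add (h2.const_mul _)

/-- The parabola minus `pairGain` vanishes at t = 1; its derivative is nonnegative beyond 1 by the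
tangent bound. On [0, 1] its sign is controlled only after a correction. -/
theorem pairGain_le {p t : ℝ} (h₁ : √2 ≤ p) (h₂ : p ≤ 1 + √2) (ht : 0 ≤ t) :
    pairGain p t ≤ pairGain p 1 + pairCDF p 1 * (t - 1) +
      (t - 1) ^ 2 / 2 * (pairCDF p 1 - pairCDF p 0 - pairSlack p / 3) := by
  set M := pairCDF p 1 - pairCDF p 0 - pairSlack p / 3 with hM
  have hc := pairSlack_nonneg h₁ h₂
  have hq : ∀ x : ℝ, HasDerivAt (fun t => pairGain p 1 + pairCDF p 1 * (t - 1) +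
      (t - 1) ^ 2 / 2 * M - pairGain p t) (pairCDF p 1 + (x - 1) * M - pairCDF p x) x := by
    intro x
    have h0 := (hasDerivAt_id x).sub_const 1
    have h3 := (((h0.const_mul (pairCDF p 1)).const_add (pairGain p 1)).add
      (((h0.pow 2).div_const 2).mul_const M)).sub (hasDerivAt_pairGain p x)
    exact h3.congr_deriv (by simp)
  rcases le_total 1 t with h | h
  · have hmono : MonotoneOn (fun t => pairGain p 1 + pairCDF p 1 * (t - 1) +
        (t - 1) ^ 2 / 2 * M - pairGain p t) (Set.Ici 1) := by
      refine monotoneOn_of_deriv_nonneg (convex_Ici 1)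
        (fun x _ => (hq x).continuousAt.continuousWithinAt)
        (fun x _ => (hq x).differentiableAt.differentiableWithinAt) fun x hx => ?_
      rw [interior_Ici, Set.mem_Ioi] at hx
      rw [(hq x).deriv]
      have e1 := pairCDF_le h₁ h₂ hx.le
      have e2 := mul_le_mul_of_nonneg_right (density_mul_le h₁ h₂) (sub_nonneg.2 hx.le)
      rw [hM]; linarith
    have := hmono Set.self_mem_Ici h h
    simp only [sub_self] at this
    linarith
  -- By `le_pairCDF` the derivative is at most (S/3)(1 - x)(1 - 3x), with S the slack; this is the
  -- derivative of (S/3)(1 - x)² x. That primitive vanishes at 0 and 1 and is nonnegative between,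
  -- so subtracting it yields a monotone function at no cost. The balance at 0 is what fixes the
  -- factor 1/3.
  · have hq' : ∀ x : ℝ, HasDerivAt (fun t => pairGain p 1 + pairCDF p 1 * (t - 1) +
        (t - 1) ^ 2 / 2 * M - pairGain p t - pairSlack p / 3 * ((1 - t) ^ 2 * t))
        (pairCDF p 1 + (x - 1) * M - pairCDF p x -
          pairSlack p / 3 * ((1 - x) * (1 - 3 * x))) x := by
      intro x
      have h0 := (hasDerivAt_id x).const_sub 1
      have h3 := (hq x).sub ((((h0.pow 2).mul (hasDerivAt_id x))).const_mul (pairSlack p / 3))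
      exact h3.congr_deriv (by simp [-mul_eq_mul_left_iff]; ring)
    have hanti : AntitoneOn (fun t => pairGain p 1 + pairCDF p 1 * (t - 1) +
        (t - 1) ^ 2 / 2 * M - pairGain p t - pairSlack p / 3 * ((1 - t) ^ 2 * t))
        (Set.Icc 0 1) := by
      refine antitoneOn_of_deriv_nonpos (convex_Icc 0 1)
        (fun x _ => (hq' x).continuousAt.continuousWithinAt)
        (fun x _ => (hq' x).differentiableAt.differentiableWithinAt) fun x hx => ?_
      rw [interior_Icc] at hx
      rw [(hq' x).deriv]
      have e1 := le_pairCDF h₁ h₂ ⟨hx.1.le, hx.2.le⟩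
      rw [hM]; linarith
    have := hanti ⟨ht, h⟩ ⟨zero_le_one, le_rfl⟩ h
    simp only [sub_self] at this
    have : 0 ≤ pairSlack p / 3 * ((1 - t) ^ 2 * t) := by positivity
    linarith

/-! ## Averaging over prices -/

theorem uIcc_price : Set.uIcc √2 (1 + √2) = Set.Icc √2 (1 + √2) :=
  Set.uIcc_of_le (by linarith)

theorem continuousOn_lowDensity : ContinuousOn lowDensity (Set.Icc √2 (1 + √2)) := by
  have := sqrt_two_gt
  unfold lowDensity
  refine continuousOn_const.div (by fun_prop) fun p hp => ?_
  have : 0 < p + 1 := by linarith [hp.1]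
  positivity

theorem continuousOn_highDensity : ContinuousOn highDensity (Set.Icc √2 (1 + √2)) := by
  have := sqrt_two_gt
  unfold highDensity
  refine continuousOn_const.div (by fun_prop) fun p hp => ?_
  have : 0 < p := by linarith [hp.1]
  positivity

theorem continuousOn_pairCDF (t : ℝ) :
    ContinuousOn (fun p => pairCDF p t) (Set.Icc √2 (1 + √2)) := by
  have h := continuous_priceCDF_one
  unfold pairCDF
  exact (continuousOn_lowDensity.mul (by fun_prop)).add (continuousOn_highDensity.mul (by fun_prop))

theorem continuousOn_pairGain (t : ℝ) :
    ContinuousOn (fun p => pairGain p t) (Set.Icc √2 (1 + √2)) := by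
  have h := continuous_cumCDF
  unfold pairGain
  exact (continuousOn_lowDensity.mul (by fun_prop)).add (continuousOn_highDensity.mul (by fun_prop))

theorem intervalIntegrable_of_price {f : ℝ → ℝ} (h : ContinuousOn f (Set.Icc √2 (1 + √2))) :
    IntervalIntegrable f volume √2 (1 + √2) :=
  ContinuousOn.intervalIntegrable (by rwa [uIcc_price])

theorem continuous_pairSlack : Continuous pairSlack := by unfold pairSlack; fun_prop

/-- `E (t + p₂ - p₁)⁺` for independent prices with distribution `Γ¹`. -/
def gain (t : ℝ) : ℝ := ∫ p in √2..(1 + √2), pairGain p t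

/-- `P(0 < p₁ - p₂ < 1)` for independent prices with distribution `Γ¹`. -/
def edge : ℝ := ∫ p in √2..(1 + √2), (pairCDF p 1 - pairCDF p 0)

/-- The margin by which the curvature of the bound on `gain` falls short of `edge`; it becomes the
length of the range of κ on which l = 2ω. -/
def edgeSlack : ℝ := ∫ p in √2..(1 + √2), pairSlack p / 3

theorem edgeSlack_pos : 0 < edgeSlack := by
  refine intervalIntegral.intervalIntegral_pos_of_pos_on
    ((continuous_pairSlack.div_const 3).intervalIntegrable _ _) (fun p hp => ?_) (by linarith)
  have := mul_pos (sub_pos.2 hp.2) (sub_pos.2 hp.1)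
  unfold pairSlack; positivity

theorem edgeSlack_lt_edge : edgeSlack < edge := by
  have hi : IntervalIntegrable (fun p => pairCDF p 1 - pairCDF p 0) volume √2 (1 + √2) :=
    intervalIntegrable_of_price ((continuousOn_pairCDF 1).sub (continuousOn_pairCDF 0))
  have hj := (continuous_pairSlack.div_const 3).intervalIntegrable (μ := volume) √2 (1 + √2)
  rw [← sub_pos, edgeSlack, edge, ← intervalIntegral.integral_sub hi hj]
  refine intervalIntegral.intervalIntegral_pos_of_pos_on (hi.sub hj) (fun p hp => ?_) (by linarith)
  have h1 := density_mul_le hp.1.le hp.2.le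
  have h2 := mul_pos (lowDensity_pos hp.1.le) (highDensity_pos hp.1.le)
  linarith

/-! ### Closed-form averages of the law of price differences -/

theorem hasDerivAt_lowCDF {p : ℝ} (hp : p + 1 ≠ 0) :
    HasDerivAt (fun p => 1 - (1 + √2) / (p + 1)) (lowDensity p) p := by
  have h := (((hasDerivAt_id p).add_const 1).inv hp).const_mul (1 + √2)
  refine (h.const_sub 1).congr_deriv ?_
  simp [lowDensity, div_eq_mul_inv]

theorem hasDerivAt_highCDF {p : ℝ} (hp : p ≠ 0) :
    HasDerivAt (fun p => 2 - (1 + √2) / p) (highDensity p) p := by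
  have h := ((hasDerivAt_id p).inv hp).const_mul (1 + √2)
  refine (h.const_sub 2).congr_deriv ?_
  simp [highDensity, div_eq_mul_inv]

/-- By symmetry, P(p₁ ≤ p₂) = 1/2 for independent atomless prices; analytically, half the sum of the
squares of the two branches is an antiderivative. -/
theorem integral_pairCDF_zero : ∫ p in √2..(1 + √2), pairCDF p 0 = 1 / 2 := by
  have h3 := sqrt_two_gt
  have h4 := sqrt_two_sq
  have h : ∀ p ∈ Set.uIcc √2 (1 + √2), HasDerivAt (fun p =>
      (1 - (1 + √2) / (p + 1)) ^ 2 / 2 + (2 - (1 + √2) / p) ^ 2 / 2) (pairCDF p 0) p := by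
    intro p hp
    rw [uIcc_price] at hp
    have h1 := hasDerivAt_lowCDF (p := p) (by linarith [hp.1])
    have h2 := hasDerivAt_highCDF (p := p) (by linarith [hp.1])
    refine (((h1.pow 2).div_const 2).add ((h2.pow 2).div_const 2)).congr_deriv ?_
    rw [pairCDF_zero hp.1 hp.2]
    simp; ring
  rw [intervalIntegral.integral_eq_sub_of_hasDerivAt h
    (intervalIntegrable_of_price (continuousOn_pairCDF 0)), one_add_sqrt_two_div,
    one_add_sqrt_two_div_sqrt_two, add_comm √2 1, div_self (by linarith)]
  ring

theorem integral_pairCDF_one : ∫ p in √2..(1 + √2), pairCDF p 1 = 1 / 2 + edge := by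
  rw [edge, intervalIntegral.integral_sub (intervalIntegrable_of_price (continuousOn_pairCDF 1))
    (intervalIntegrable_of_price (continuousOn_pairCDF 0)), integral_pairCDF_zero]
  ring

/-- After rescaling, the integral is P(p₁ - p₂ > 1): a gap above 1 requires p₁ on the upper branch
and p₂ on the lower one. -/
theorem P₁_self {l : ℝ} (hl : 0 < l) : P₁ l l = 1 / 2 - edge := by
  have h3 := sqrt_two_gt
  have hsc : P₁ l l = ∫ p in √2..(1 + √2), highDensity p * (1 - (1 + √2) / (p + 1)) := by
    have h := intervalIntegral.smul_integral_comp_mul_left (a := √2) (b := 1 + √2)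
      (fun p => deriv (gammaH l) (p + l) * gammaL l p) l
    rw [P₁, show (2 + √2) * l - l = l * (1 + √2) by ring, mul_comm √2 l, ← h, smul_eq_mul,
      ← intervalIntegral.integral_const_mul]
    refine intervalIntegral.integral_congr fun p hp => ?_
    rw [uIcc_price] at hp
    have hp0 : 0 < p := by linarith [hp.1]
    have hne : l - (l * p + l) ≠ 0 := by
      have : 0 < l * p := by positivity
      linarith
    have hd : HasDerivAt (gammaH l) ((1 + √2) / (l * p ^ 2)) (l * p + l) := by
      have h1 := ((hasDerivAt_id (l * p + l)).const_mul 2).const_sub ((3 + √2) * l)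
      have h2 := (hasDerivAt_id (l * p + l)).const_sub l
      refine (h1.div h2 hne).congr_deriv ?_
      simp only [id]
      rw [show l - (l * p + l) = -(l * p) by ring]
      field_simp
      ring
    rw [hd.deriv, gammaL, highDensity]
    field_simp
    ring
  -- Integration by parts: with Γ_L(p) and Γ_H(p + 1) the two branches, the antiderivative Γ_L Γ_H +
  -- Γ_H gains exactly 1 over the interval, so the two probabilities are complementary.
  have h : ∀ p ∈ Set.uIcc √2 (1 + √2), HasDerivAt (fun p =>
      (1 - (1 + √2) / (p + 1)) * (2 - (1 + √2) / p) + (2 - (1 + √2) / p))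
      (pairCDF p 1 + highDensity p * (1 - (1 + √2) / (p + 1))) p := by
    intro p hp
    rw [uIcc_price] at hp
    have h1 := hasDerivAt_lowCDF (p := p) (by linarith [hp.1])
    have h2 := hasDerivAt_highCDF (p := p) (by linarith [hp.1])
    refine ((h1.mul h2).add h2).congr_deriv ?_
    rw [pairCDF_one hp.1 hp.2]
    ring
  have hi : IntervalIntegrable (fun p => highDensity p * (1 - (1 + √2) / (p + 1))) volume √2
      (1 + √2) := by
    refine intervalIntegrable_of_price (continuousOn_highDensity.mul fun p hp => ?_)
    exact (hasDerivAt_lowCDF (p := p) (by linarith [hp.1])).continuousAt.continuousWithinAt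
  have hj := intervalIntegrable_of_price (continuousOn_pairCDF 1)
  have htot := intervalIntegral.integral_eq_sub_of_hasDerivAt h (hj.add hi)
  rw [intervalIntegral.integral_add hj hi, ← hsc, integral_pairCDF_one, one_add_sqrt_two_div,
    one_add_sqrt_two_div_sqrt_two, add_comm √2 1, div_self (by linarith)] at htot
  linarith

theorem gain_le {t : ℝ} (ht : 0 ≤ t) :
    gain t ≤ gain 1 + (1 / 2 + edge) * (t - 1) + (t - 1) ^ 2 / 2 * (edge - edgeSlack) := by
  have h1 := intervalIntegrable_of_price (continuousOn_pairCDF 1)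
  have hg := intervalIntegrable_of_price (continuousOn_pairGain 1)
  have hd : IntervalIntegrable (fun p => pairCDF p 1 - pairCDF p 0) volume √2 (1 + √2) :=
    intervalIntegrable_of_price ((continuousOn_pairCDF 1).sub (continuousOn_pairCDF 0))
  have hj := (continuous_pairSlack.div_const 3).intervalIntegrable (μ := volume) √2 (1 + √2)
  have hdj : IntervalIntegrable (fun p => pairCDF p 1 - pairCDF p 0 - pairSlack p / 3) volume √2
      (1 + √2) := hd.sub hj
  have hm := hdj.const_mul ((t - 1) ^ 2 / 2)
  have h1' := h1.mul_const (t - 1)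
  have hl : IntervalIntegrable (fun p => pairGain p 1 + pairCDF p 1 * (t - 1)) volume √2
      (1 + √2) := hg.add h1'
  have key := intervalIntegral.integral_mono_on (by linarith : √2 ≤ 1 + √2)
    (intervalIntegrable_of_price (continuousOn_pairGain t)) (hl.add hm)
    fun p hp => pairGain_le hp.1 hp.2 ht
  rw [intervalIntegral.integral_add hl hm, intervalIntegral.integral_const_mul,
    intervalIntegral.integral_sub hd hj, intervalIntegral.integral_add hg h1',
    intervalIntegral.integral_mul_const, integral_pairCDF_one] at key
  exact key

/-! ## The law of prices -/

/-- The measure on `(√2, 1 + √2]` with density `f`. -/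
def pieceLaw (f : ℝ → ℝ) : Measure ℝ :=
  (volume.restrict (Set.Ioc √2 (1 + √2))).withDensity fun p => ENNReal.ofReal (f p)

/-- The measure with distribution function `Γ¹`. -/
def unitPrice : Measure ℝ := pieceLaw lowDensity + (pieceLaw highDensity).map (· + 1)

theorem measurable_lowDensity : Measurable lowDensity := by unfold lowDensity; fun_prop

theorem measurable_highDensity : Measurable highDensity := by unfold highDensity; fun_prop

theorem pieceLaw_Iic {f g : ℝ → ℝ} (hf : ContinuousOn f (Set.Icc √2 (1 + √2)))
    (h0 : ∀ p ∈ Set.Icc √2 (1 + √2), 0 ≤ f p)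
    (hg : ∀ p ∈ Set.Icc √2 (1 + √2), HasDerivAt g (f p) p) (x : ℝ) :
    pieceLaw f (Set.Iic x) = ENNReal.ofReal (g (clampPrice x) - g √2) := by
  have hle := sqrt_two_le_clampPrice x
  have hsub : Set.Icc √2 (clampPrice x) ⊆ Set.Icc √2 (1 + √2) :=
    Set.Icc_subset_Icc_right (clampPrice_le x)
  have hset : Set.Iic x ∩ Set.Ioc √2 (1 + √2) = Set.Ioc √2 (clampPrice x) := by
    ext p
    simp only [Set.mem_inter_iff, Set.mem_Iic, Set.mem_Ioc, clampPrice, le_max_iff, le_min_iff]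
    constructor
    · rintro ⟨h1, h2, h3⟩; exact ⟨h2, Or.inr ⟨h1, h3⟩⟩
    · rintro ⟨h2, h | h⟩
      · exact absurd h2 (not_lt.2 h)
      · exact ⟨h.1, h2, h.2⟩
  have hii : IntervalIntegrable f volume √2 (clampPrice x) :=
    (hf.mono (by rw [Set.uIcc_of_le hle]; exact hsub)).intervalIntegrable
  rw [pieceLaw, withDensity_apply _ measurableSet_Iic, Measure.restrict_restrict measurableSet_Iic,
    hset, ← ofReal_integral_eq_lintegral_ofReal, ← intervalIntegral.integral_of_le hle,
    intervalIntegral.integral_eq_sub_of_hasDerivAt (f := g) _ hii]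
  · intro p hp
    rw [Set.uIcc_of_le hle] at hp
    exact hg p (hsub hp)
  · exact (intervalIntegrable_iff_integrableOn_Ioc_of_le hle).1 hii
  · filter_upwards [ae_restrict_mem measurableSet_Ioc] with p hp
    exact h0 p (hsub (Set.Ioc_subset_Icc_self hp))

theorem unitPrice_Iic (x : ℝ) : unitPrice (Set.Iic x) = ENNReal.ofReal (priceCDF 1 x) := by
  have h3 := sqrt_two_gt
  have hpre : (fun p : ℝ => p + 1) ⁻¹' Set.Iic x = Set.Iic (x - 1) := by
    ext p; simp [le_sub_iff_add_le]
  rw [unitPrice, Measure.add_apply, Measure.map_apply (by fun_prop) measurableSet_Iic, hpre,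
    pieceLaw_Iic continuousOn_lowDensity (fun p hp => (lowDensity_pos hp.1).le)
      (fun p hp => hasDerivAt_lowCDF (by linarith [hp.1])),
    pieceLaw_Iic continuousOn_highDensity (fun p hp => (highDensity_pos hp.1).le)
      (fun p hp => hasDerivAt_highCDF (by linarith [hp.1])), ← ENNReal.ofReal_add, priceCDF_one_eq]
  · rw [add_comm √2 1, div_self (by linarith)]
    congr 1; ring
  · have := sqrt_two_le_clampPrice x
    have : (1 + √2) / (clampPrice x + 1) ≤ (1 + √2) / (√2 + 1) := by gcongr
    linarith
  · have := sqrt_two_le_clampPrice (x - 1)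
    have : (1 + √2) / clampPrice (x - 1) ≤ (1 + √2) / √2 := by gcongr
    linarith

instance : IsProbabilityMeasure unitPrice := by
  refine ⟨?_⟩
  have h := tendsto_measure_iUnion_atTop (μ := unitPrice) (s := fun n : ℕ => Set.Iic (n : ℝ))
    fun m n h => Set.Iic_subset_Iic.2 (by exact_mod_cast h)
  have hU : ⋃ n : ℕ, Set.Iic (n : ℝ) = Set.univ := by
    ext x; simpa using exists_nat_ge x
  rw [hU] at h
  refine tendsto_nhds_unique h (tendsto_const_nhds.congr' ?_)
  filter_upwards [eventually_ge_atTop 4] with n hn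
  have hn' : (4 : ℝ) ≤ n := by exact_mod_cast hn
  have := sqrt_two_lt
  simp only [Function.comp, unitPrice_Iic]
  rw [priceCDF_one_top (by linarith), ENNReal.ofReal_one]

theorem cdf_unitPrice (x : ℝ) : cdf unitPrice x = priceCDF 1 x := by
  rw [cdf_eq_real, measureReal_def, unitPrice_Iic, ENNReal.toReal_ofReal (priceCDF_one_nonneg x)]

theorem nullSingletonClass_pieceLaw (f : ℝ → ℝ) : NullSingletonClass (pieceLaw f) :=
  ⟨fun x => (withDensity_absolutelyContinuous _ _) (measure_singleton x)⟩

instance : NullSingletonClass unitPrice := by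
  refine ⟨fun x => ?_⟩
  have hpre : (fun p : ℝ => p + 1) ⁻¹' {x} = {x - 1} := by
    ext p; simp only [Set.mem_preimage, Set.mem_singleton_iff, eq_sub_iff_add_eq]
  have := nullSingletonClass_pieceLaw lowDensity
  have := nullSingletonClass_pieceLaw highDensity
  rw [unitPrice, Measure.add_apply, Measure.map_apply (by fun_prop) (measurableSet_singleton x),
    hpre, measure_singleton, measure_singleton, add_zero]

theorem ae_unitPrice_mem : ∀ᵐ p ∂unitPrice, p ∈ Set.Icc √2 (2 + √2) := by
  have h1 : ∀ᵐ p ∂unitPrice, p ∉ Set.Iic √2 := by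
    rw [← measure_eq_zero_iff_ae_notMem, unitPrice_Iic, priceCDF_one_bot le_rfl, ENNReal.ofReal_zero]
  have h2 : ∀ᵐ p ∂unitPrice, p ∈ Set.Iic (2 + √2) := by
    refine (mem_ae_iff_prob_eq_one measurableSet_Iic).2 ?_
    rw [unitPrice_Iic, priceCDF_one_top le_rfl, ENNReal.ofReal_one]
  filter_upwards [h1, h2] with p hp hp'
  exact ⟨(not_le.1 hp).le, hp'⟩

theorem integrable_unitPrice {ψ : ℝ → ℝ} (hψ : Continuous ψ) : Integrable ψ unitPrice := by
  have h := hψ.continuousOn.integrableOn_compact (μ := unitPrice)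
    (isCompact_Icc (a := √2) (b := 2 + √2))
  rwa [IntegrableOn, Measure.restrict_eq_self_of_ae_mem ae_unitPrice_mem] at h

theorem integral_pieceLaw {f ψ : ℝ → ℝ} (hf : Measurable f)
    (h0 : ∀ p ∈ Set.Icc √2 (1 + √2), 0 ≤ f p) :
    ∫ p, ψ p ∂pieceLaw f = ∫ p in √2..(1 + √2), f p * ψ p := by
  rw [pieceLaw, integral_withDensity_eq_integral_toReal_smul (by fun_prop) (by simp),
    intervalIntegral.integral_of_le (by linarith)]
  refine setIntegral_congr_fun measurableSet_Ioc fun p hp => ?_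
  simp only [smul_eq_mul]
  rw [ENNReal.toReal_ofReal (h0 p (Set.Ioc_subset_Icc_self hp))]

theorem integral_unitPrice {ψ : ℝ → ℝ} (hψ : Continuous ψ) : ∫ p, ψ p ∂unitPrice =
    ∫ p in √2..(1 + √2), (lowDensity p * ψ p + highDensity p * ψ (p + 1)) := by
  have hi := integrable_unitPrice hψ
  rw [unitPrice, integrable_add_measure] at hi
  have he : MeasurableEmbedding fun p : ℝ => p + 1 := measurableEmbedding_addRight 1
  rw [unitPrice, integral_add_measure hi.1 hi.2, he.integral_map,
    integral_pieceLaw measurable_lowDensity fun p hp => (lowDensity_pos hp.1).le,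
    integral_pieceLaw measurable_highDensity fun p hp => (highDensity_pos hp.1).le,
    intervalIntegral.integral_add]
  · exact intervalIntegrable_of_price (continuousOn_lowDensity.mul hψ.continuousOn)
  · exact intervalIntegrable_of_price (continuousOn_highDensity.mul (by fun_prop))

/-- Layer-cake formula. As prices exceed √2 > 0, the distribution function vanishes on the negative
half-line and the antiderivative may start at 0. -/
theorem integral_posPart_unitPrice (z : ℝ) : ∫ p, max (z - p) 0 ∂unitPrice = cumCDF z := by
  have hi : Integrable (fun p : ℝ => max (z - p) 0) unitPrice :=
    integrable_unitPrice (by fun_prop)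
  rw [hi.integral_eq_integral_meas_le (ae_of_all _ fun p => le_max_right _ _)]
  have e : ∀ t ∈ Set.Ioi (0 : ℝ), unitPrice.real {p | t ≤ max (z - p) 0} = priceCDF 1 (z - t) := by
    intro t ht
    have : {p : ℝ | t ≤ max (z - p) 0} = Set.Iic (z - t) := by
      ext p
      simp only [Set.mem_ofPred_eq, Set.mem_Iic, le_max_iff, not_le.2 (Set.mem_Ioi.1 ht), or_false]
      constructor <;> intro <;> linarith
    rw [this, ← cdf_eq_real, cdf_unitPrice]
  rw [setIntegral_congr_fun measurableSet_Ioi e]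
  have h3 := sqrt_two_gt
  set T := max z 0 with hT
  have hsplit : ∫ t in Set.Ioi (0 : ℝ), priceCDF 1 (z - t) =
      ∫ t in (0 : ℝ)..T, priceCDF 1 (z - t) := by
    rw [intervalIntegral.integral_of_le (le_max_right _ _)]
    refine setIntegral_eq_of_subset_of_forall_sdiff_eq_zero measurableSet_Ioi
      Set.Ioc_subset_Ioi_self fun t ht => priceCDF_one_bot ?_
    have h1 : T < t := by
      by_contra h
      exact ht.2 ⟨ht.1, not_lt.1 h⟩
    have : z ≤ T := le_max_left _ _
    linarith
  rw [hsplit, intervalIntegral.integral_comp_sub_left (fun t => priceCDF 1 t), sub_zero, cumCDF]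
  rcases le_total 0 z with h | h
  · rw [hT, max_eq_left h, sub_self]
  · rw [hT, max_eq_right h, sub_zero, intervalIntegral.integral_same,
      intervalIntegral.integral_symm, intervalIntegral.integral_of_le h,
      setIntegral_congr_fun (g := fun _ => (0 : ℝ)) measurableSet_Ioc]
    · simp
    · exact fun t ht => priceCDF_one_bot (by linarith [ht.2])

theorem integral_cumCDF_unitPrice (t : ℝ) : ∫ p, cumCDF (p + t) ∂unitPrice = gain t := by
  have h := continuous_cumCDF
  rw [integral_unitPrice (ψ := fun p => cumCDF (p + t)) (by fun_prop)]
  rfl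

/-- The law of prices with distribution function `Γˡ`. -/
def priceLaw (l : ℝ) : Measure ℝ := unitPrice.map (l * ·)

instance (l : ℝ) : IsProbabilityMeasure (priceLaw l) :=
  Measure.isProbabilityMeasure_map (by fun_prop)

theorem integral_priceLaw {l : ℝ} (hl : 0 < l) (ψ : ℝ → ℝ) :
    ∫ p, ψ p ∂priceLaw l = ∫ p, ψ (l * p) ∂unitPrice :=
  (measurableEmbedding_mulLeft₀ hl.ne').integral_map ψ

theorem integrable_priceLaw {l : ℝ} (hl : 0 < l) {ψ : ℝ → ℝ} (hψ : Continuous ψ) :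
    Integrable ψ (priceLaw l) := by
  rw [priceLaw, (measurableEmbedding_mulLeft₀ hl.ne').integrable_map_iff]
  exact integrable_unitPrice (hψ.comp (by fun_prop))

theorem cdf_priceLaw {l : ℝ} (hl : 0 < l) (x : ℝ) : cdf (priceLaw l) x = priceCDF l x := by
  have hpre : (fun p : ℝ => l * p) ⁻¹' Set.Iic x = Set.Iic (x / l) := by
    ext p; simp [le_div_iff₀ hl, mul_comm]
  rw [cdf_eq_real, priceLaw, map_measureReal_apply (by fun_prop) measurableSet_Iic, hpre,
    ← cdf_eq_real, cdf_unitPrice, priceCDF_eq_div hl]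

theorem nullSingletonClass_priceLaw {l : ℝ} (hl : 0 < l) : NullSingletonClass (priceLaw l) := by
  refine ⟨fun x => ?_⟩
  have hpre : (fun p : ℝ => l * p) ⁻¹' {x} = {x / l} := by
    ext p; simp [eq_div_iff hl.ne', mul_comm]
  rw [priceLaw, Measure.map_apply (by fun_prop) (measurableSet_singleton x), hpre,
    measure_singleton]

/-! ## The firms -/

theorem measurable_buysFirst {tie : ℝ × ℝ → ℝ × ℝ → ℝ} (ht : IsTieRule tie) :
    Measurable fun s : (ℝ × ℝ) × (ℝ × ℝ) => buysFirst tie s.1 s.2 := by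
  unfold buysFirst
  have h := ht.measurable
  refine Measurable.ite (measurableSet_lt (by fun_prop) (by fun_prop)) measurable_const
    (Measurable.ite (measurableSet_lt (by fun_prop) (by fun_prop)) measurable_const h)

theorem buysFirst_mem {tie : ℝ × ℝ → ℝ × ℝ → ℝ} (ht : IsTieRule tie) (q p : ℝ × ℝ) :
    buysFirst tie q p ∈ Set.Icc (0 : ℝ) 1 := by
  unfold buysFirst
  split_ifs
  · simp
  · simp
  · exact ht.mem q p

section Firm

variable {tie : ℝ × ℝ → ℝ × ℝ → ℝ} {F : Measure (ℝ × ℝ)} {G G₁ G₂ : Measure ℝ}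

theorem integral_buysFirst (tie : ℝ × ℝ → ℝ × ℝ → ℝ) [IsProbabilityMeasure G]
    [NullSingletonClass G] (q : ℝ × ℝ) (p : ℝ) :
    ∫ p₂, buysFirst tie q (p, p₂) ∂G = 1 - cdf G (p + (q.2 - q.1)) := by
  have h : (fun p₂ => buysFirst tie q (p, p₂)) =ᵐ[G]
      (Set.Iic (p + (q.2 - q.1)))ᶜ.indicator fun _ => (1 : ℝ) := by
    filter_upwards [Measure.ae_ne G (p + (q.2 - q.1))] with p₂ hp
    simp only [buysFirst, Set.indicator, Set.mem_compl_iff, Set.mem_Iic]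
    rcases lt_or_gt_of_ne hp with h | h
    · rw [if_neg (by linarith), if_pos (by linarith), if_neg (not_not.2 h.le)]
    · rw [if_pos (by linarith), if_pos (not_le.2 h)]
  rw [integral_congr_ae h, integral_indicator measurableSet_Iic.compl, setIntegral_const,
    smul_eq_mul, mul_one, probReal_compl_eq_one_sub measurableSet_Iic, cdf_eq_real]

theorem integral_one_sub_buysFirst (tie : ℝ × ℝ → ℝ × ℝ → ℝ) [IsProbabilityMeasure G]
    [NullSingletonClass G] (q : ℝ × ℝ) (p : ℝ) :
    ∫ p₁, (1 - buysFirst tie q (p₁, p)) ∂G = 1 - cdf G (p + (q.1 - q.2)) := by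
  have h : (fun p₁ => 1 - buysFirst tie q (p₁, p)) =ᵐ[G]
      (Set.Iic (p + (q.1 - q.2)))ᶜ.indicator fun _ => (1 : ℝ) := by
    filter_upwards [Measure.ae_ne G (p + (q.1 - q.2))] with p₂ hp
    simp only [buysFirst, Set.indicator, Set.mem_compl_iff, Set.mem_Iic]
    rcases lt_or_gt_of_ne hp with h | h
    · rw [if_pos (by linarith), if_neg (not_not.2 h.le), sub_self]
    · rw [if_neg (by linarith), if_pos (by linarith), if_pos (not_le.2 h), sub_zero]
  rw [integral_congr_ae h, integral_indicator measurableSet_Iic.compl, setIntegral_const,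
    smul_eq_mul, mul_one, probReal_compl_eq_one_sub measurableSet_Iic, cdf_eq_real]

theorem integral_twoPoint (l : ℝ) (f : ℝ × ℝ → ℝ) : ∫ q, f q ∂twoPoint l =
    (f ((1 - l) / 2, (1 + l) / 2) + f ((1 + l) / 2, (1 - l) / 2)) / 2 := by
  rw [twoPoint, integral_add_measure, integral_smul_measure, integral_smul_measure,
    integral_dirac, integral_dirac]
  · simp; ring
  · exact (integrable_dirac (by simp)).smul_measure (by simp)
  · exact (integrable_dirac (by simp)).smul_measure (by simp)

instance (l : ℝ) : IsProbabilityMeasure (twoPoint l) := by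
  refine ⟨?_⟩
  rw [twoPoint, Measure.add_apply, Measure.smul_apply, Measure.smul_apply, measure_univ,
    measure_univ, smul_eq_mul, mul_one, ENNReal.inv_two_add_inv_two]

/-- Fubini: the rival's offer is shifted by ±l with equal probability. Only the rival's law must be
atomless, so this applies to deviations to a single price as well. -/
theorem profitOne_twoPoint (ht : IsTieRule tie) [IsProbabilityMeasure G₁] [IsProbabilityMeasure G₂]
    [NullSingletonClass G₂] (hi : Integrable (fun p : ℝ => p) G₁) (l : ℝ) :
    profitOne tie (twoPoint l) G₁ G₂ =
      ∫ p, p * ((1 - cdf G₂ (p + l)) + (1 - cdf G₂ (p - l))) / 2 ∂G₁ := by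
  have hm := measurable_buysFirst ht
  have hb : ∀ q p, ‖buysFirst tie q p‖ ≤ 1 := fun q p => by
    rw [Real.norm_of_nonneg (buysFirst_mem ht q p).1]; exact (buysFirst_mem ht q p).2
  have hint : Integrable (fun s : (ℝ × ℝ) × (ℝ × ℝ) => s.2.1 * buysFirst tie s.1 s.2)
      ((twoPoint l).prod (G₁.prod G₂)) :=
    ((hi.comp_fst G₂).comp_snd (twoPoint l)).mul_bdd hm.aestronglyMeasurable
      (ae_of_all _ fun s => hb _ _)
  have hint' : ∀ q, Integrable (fun p : ℝ × ℝ => p.1 * buysFirst tie q p) (G₁.prod G₂) := fun q =>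
    (hi.comp_fst G₂).mul_bdd (hm.comp (by fun_prop : Measurable fun p : ℝ × ℝ =>
      (q, p))).aestronglyMeasurable (ae_of_all _ fun s => hb _ _)
  have hq : ∀ q, ∫ p, p.1 * buysFirst tie q p ∂(G₁.prod G₂) =
      ∫ p, p * (1 - cdf G₂ (p + (q.2 - q.1))) ∂G₁ := fun q => by
    rw [integral_prod _ (hint' q)]
    refine integral_congr_ae (ae_of_all _ fun p => ?_)
    simp only [integral_const_mul, integral_buysFirst]
  have hj : ∀ q : ℝ × ℝ, Integrable (fun p => p * (1 - cdf G₂ (p + (q.2 - q.1)))) G₁ := fun q => by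
    have := (hint' q).integral_prod_left
    simpa only [integral_const_mul, integral_buysFirst] using this
  rw [profitOne, integral_prod _ hint, integral_twoPoint]
  simp only
  rw [hq, hq, ← integral_add (hj _) (hj _), ← integral_div]
  refine integral_congr_ae (ae_of_all _ fun p => ?_)
  simp only
  rw [show (1 + l) / 2 - (1 - l) / 2 = l by ring, show (1 - l) / 2 - (1 + l) / 2 = -l by ring,
    ← sub_eq_add_neg]
  ring

theorem profitTwo_twoPoint (ht : IsTieRule tie) [IsProbabilityMeasure G₁] [IsProbabilityMeasure G₂]
    [NullSingletonClass G₁] (hi : Integrable (fun p : ℝ => p) G₂) (l : ℝ) :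
    profitTwo tie (twoPoint l) G₁ G₂ =
      ∫ p, p * ((1 - cdf G₁ (p + l)) + (1 - cdf G₁ (p - l))) / 2 ∂G₂ := by
  have hm := measurable_buysFirst ht
  have hb : ∀ q p, ‖1 - buysFirst tie q p‖ ≤ 1 := fun q p => by
    rw [Real.norm_of_nonneg (sub_nonneg.2 (buysFirst_mem ht q p).2)]
    linarith [(buysFirst_mem ht q p).1]
  have hint : Integrable (fun s : (ℝ × ℝ) × (ℝ × ℝ) => s.2.2 * (1 - buysFirst tie s.1 s.2))
      ((twoPoint l).prod (G₁.prod G₂)) :=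
    ((hi.comp_snd G₁).comp_snd (twoPoint l)).mul_bdd
      (measurable_const.sub hm).aestronglyMeasurable (ae_of_all _ fun s => hb _ _)
  have hint' : ∀ q, Integrable (fun p : ℝ × ℝ => p.2 * (1 - buysFirst tie q p)) (G₁.prod G₂) :=
    fun q => (hi.comp_snd G₁).mul_bdd ((measurable_const.sub hm).comp
      (by fun_prop : Measurable fun p : ℝ × ℝ => (q, p))).aestronglyMeasurable
      (ae_of_all _ fun s => hb _ _)
  have hq : ∀ q, ∫ p, p.2 * (1 - buysFirst tie q p) ∂(G₁.prod G₂) =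
      ∫ p, p * (1 - cdf G₁ (p + (q.1 - q.2))) ∂G₂ := fun q => by
    rw [integral_prod_symm _ (hint' q)]
    refine integral_congr_ae (ae_of_all _ fun p => ?_)
    simp only [integral_const_mul, integral_one_sub_buysFirst]
  have hj : ∀ q : ℝ × ℝ, Integrable (fun p => p * (1 - cdf G₁ (p + (q.1 - q.2)))) G₂ := fun q => by
    have := (hint' q).integral_prod_right
    simpa only [integral_const_mul, integral_one_sub_buysFirst] using this
  rw [profitTwo, integral_prod _ hint, integral_twoPoint]
  simp only
  rw [hq, hq, ← integral_add (hj _) (hj _), ← integral_div]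
  refine integral_congr_ae (ae_of_all _ fun p => ?_)
  simp only
  rw [show (1 + l) / 2 - (1 - l) / 2 = l by ring, show (1 - l) / 2 - (1 + l) / 2 = -l by ring,
    ← sub_eq_add_neg]
  ring

end Firm

/-- Revenue at price `p` when the competitor prices according to `Γˡ`. -/
def revenue (l p : ℝ) : ℝ := p * ((1 - priceCDF l (p + l)) + (1 - priceCDF l (p - l))) / 2

/-- On the support one of the two demand terms is constant and the other is hyperbolic in p, so
revenue is flat. Just outside it the claim is a quadratic inequality with equality at √2,
respectively 2 + √2. -/
theorem revenue_one_le (p : ℝ) : revenue 1 p ≤ (1 + √2) / 2 := by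
  have h3 := sqrt_two_gt
  have h3' := sqrt_two_lt
  have h4 := sqrt_two_sq
  unfold revenue
  have a1 := priceCDF_one_nonneg (p + 1)
  have a2 := priceCDF_one_nonneg (p - 1)
  have a3 := priceCDF_one_le_one (p + 1)
  have a4 := priceCDF_one_le_one (p - 1)
  rcases le_total p 0 with c0 | c0
  · nlinarith
  rcases le_total p (√2 - 1) with c1 | c1
  · nlinarith
  rcases le_total p √2 with c2 | c2
  · rw [priceCDF_one_low (by linarith) (by linarith), priceCDF_one_bot (by linarith)]
    have : p * ((1 + √2) / (p + 1 + 1)) ≤ 1 + √2 - p := by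
      rw [← mul_div_assoc, div_le_iff₀ (by linarith)]; nlinarith
    linarith
  rcases le_total p (1 + √2) with c3 | c3
  · rw [priceCDF_one_high (by linarith) (by linarith), priceCDF_one_bot (by linarith)]
    have : p * ((1 + √2) / (p + 1 - 1)) = 1 + √2 := by
      have : p ≠ 0 := by linarith
      rw [add_sub_cancel_right]; field_simp
    linarith
  rcases le_total p (2 + √2) with c4 | c4
  · rw [priceCDF_one_top (by linarith), priceCDF_one_low (by linarith) (by linarith)]
    have : p * ((1 + √2) / (p - 1 + 1)) = 1 + √2 := by
      have : p ≠ 0 := by linarith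
      rw [sub_add_cancel]; field_simp
    linarith
  rcases le_total p (3 + √2) with c5 | c5
  · rw [priceCDF_one_top (by linarith), priceCDF_one_high (by linarith) (by linarith)]
    have : p * ((1 + √2) / (p - 1 - 1)) ≤ 1 + √2 + p := by
      rw [← mul_div_assoc, div_le_iff₀ (by linarith)]; nlinarith
    linarith
  · rw [priceCDF_one_top (by linarith), priceCDF_one_top (by linarith)]
    linarith

theorem revenue_one_eq {p : ℝ} (hp : p ∈ Set.Icc √2 (2 + √2)) : revenue 1 p = (1 + √2) / 2 := by
  have h3 := sqrt_two_gt
  obtain ⟨c2, c4⟩ := hp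
  have : p ≠ 0 := by linarith
  unfold revenue
  rcases le_total p (1 + √2) with c3 | c3
  · rw [priceCDF_one_high (by linarith) (by linarith), priceCDF_one_bot (by linarith)]
    rw [add_sub_cancel_right]; field_simp
    ring
  · rw [priceCDF_one_top (by linarith), priceCDF_one_low (by linarith) (by linarith)]
    rw [sub_add_cancel]; field_simp
    ring

theorem revenue_eq_mul {l : ℝ} (hl : 0 < l) (p : ℝ) : revenue l p = l * revenue 1 (p / l) := by
  unfold revenue
  rw [priceCDF_eq_div hl, priceCDF_eq_div hl (p - l), add_div, sub_div, div_self hl.ne']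
  field_simp

theorem integral_revenue_le {l : ℝ} (hl : 0 < l) (p : ℝ) :
    ∫ p', p' * ((1 - cdf (priceLaw l) (p' + l)) + (1 - cdf (priceLaw l) (p' - l))) / 2
        ∂(Measure.dirac p) ≤
      ∫ p', p' * ((1 - cdf (priceLaw l) (p' + l)) + (1 - cdf (priceLaw l) (p' - l))) / 2
        ∂(priceLaw l) := by
  simp only [cdf_priceLaw hl]
  rw [integral_dirac]
  change revenue l p ≤ ∫ p, revenue l p ∂priceLaw l
  rw [integral_priceLaw hl]
  have h : ∫ p, revenue l (l * p) ∂unitPrice = ∫ _, l * ((1 + √2) / 2) ∂unitPrice := by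
    refine integral_congr_ae ?_
    filter_upwards [ae_unitPrice_mem] with p hp
    rw [revenue_eq_mul hl, mul_div_cancel_left₀ _ hl.ne', revenue_one_eq hp]
  rw [h, integral_const, probReal_univ, one_smul]
  refine (revenue_eq_mul hl p).trans_le ?_
  exact mul_le_mul_of_nonneg_left (revenue_one_le _) hl.le

/-! ## The cost of information -/

/-- `φ(t) + φ(1 - t)`, as a real number. -/
def sideCost (φ : ℝ → EReal) (t : ℝ) : ℝ := costReal φ t (1 / 2)

/-- The derivative in `d` of the cost of the posterior `((1 + d) / 2, (1 - d) / 2)`. -/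
def margCost (φ : ℝ → EReal) (d : ℝ) : ℝ := deriv (sideCost φ) ((1 + d) / 2)

theorem cost_swap (φ : ℝ → EReal) (q : ℝ × ℝ) : cost φ q.swap = cost φ q := by
  simp only [cost, Prod.fst_swap, Prod.snd_swap]; abel

theorem cost_reflect (φ : ℝ → EReal) (x y : ℝ) : cost φ (1 - y, 1 - x) = cost φ (x, y) := by
  simp only [cost, sub_sub_cancel]; abel

theorem sideCost_reflect (φ : ℝ → EReal) (t : ℝ) : sideCost φ (1 - t) = sideCost φ t := by
  simp only [sideCost, costReal, cost, sub_sub_cancel]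
  rw [add_comm (φ (1 - t))]

theorem deriv_sideCost_reflect (φ : ℝ → EReal) (t : ℝ) :
    deriv (sideCost φ) (1 - t) = -deriv (sideCost φ) t := by
  have h := deriv_comp_const_sub (f := sideCost φ) 1 t
  simp only [sideCost_reflect] at h
  rw [h, neg_neg]

theorem margCost_zero (φ : ℝ → EReal) : margCost φ 0 = 0 := by
  have h := deriv_sideCost_reflect φ (1 / 2)
  rw [show (1 : ℝ) - 1 / 2 = 1 / 2 by norm_num] at h
  rw [margCost, add_zero]; linarith

theorem margCost_eq_neg (φ : ℝ → EReal) (d : ℝ) :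
    margCost φ d = -deriv (sideCost φ) ((1 - d) / 2) := by
  rw [margCost, ← deriv_sideCost_reflect]; congr 1; ring

theorem IsCost.effective {φ : ℝ → EReal} (h : IsCost φ) {x y : ℝ} (hx : x ∈ Set.Ioo (0 : ℝ) 1)
    (hy : y ∈ Set.Ioo (0 : ℝ) 1) : (x, y) ∈ {q | q ∈ square ∧ cost φ q ≠ ⊤} := by
  have hx' : 1 - x ∈ Set.Ioo (0 : ℝ) 1 := ⟨by linarith [hx.2], by linarith [hx.1]⟩
  have hy' : 1 - y ∈ Set.Ioo (0 : ℝ) 1 := ⟨by linarith [hy.2], by linarith [hy.1]⟩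
  refine ⟨⟨Set.Ioo_subset_Icc_self hx, Set.Ioo_subset_Icc_self hy⟩, ?_⟩
  exact EReal.add_ne_top (EReal.add_ne_top (EReal.add_ne_top (h.finite _ hx) (h.finite _ hx'))
    (h.finite _ hy)) (h.finite _ hy')

theorem IsCost.costReal_eq {φ : ℝ → EReal} (h : IsCost φ) {x y : ℝ} (hx : x ∈ Set.Ioo (0 : ℝ) 1)
    (hy : y ∈ Set.Ioo (0 : ℝ) 1) : costReal φ x y = sideCost φ x + sideCost φ y := by
  have hr : ∀ z ∈ Set.Ioo (0 : ℝ) 1, ∃ r : ℝ, φ z = r := fun z hz =>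
    ⟨(φ z).toReal, (EReal.coe_toReal (h.finite z hz)
      (h.ne_bot z (Set.Ioo_subset_Icc_self hz))).symm⟩
  obtain ⟨a, ha⟩ := hr x hx
  obtain ⟨b, hb⟩ := hr (1 - x) ⟨by linarith [hx.2], by linarith [hx.1]⟩
  obtain ⟨c, hc⟩ := hr y hy
  obtain ⟨d, hd⟩ := hr (1 - y) ⟨by linarith [hy.2], by linarith [hy.1]⟩
  have h2 : (1 : ℝ) - 1 / 2 = 1 / 2 := by norm_num
  simp only [sideCost, costReal, cost, ha, hb, hc, hd, h2, h.half, add_zero, ← EReal.coe_add,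
    EReal.toReal_coe]
  ring

theorem IsCost.sideCost_half {φ : ℝ → EReal} (h : IsCost φ) : sideCost φ (1 / 2) = 0 := by
  have h2 : (1 : ℝ) - 1 / 2 = 1 / 2 := by norm_num
  simp [sideCost, costReal, cost, h2, -one_div, h.half]

theorem half_mem : (1 / 2 : ℝ) ∈ Set.Ioo (0 : ℝ) 1 := ⟨by norm_num, by norm_num⟩

theorem IsCost.differentiableAt {φ : ℝ → EReal} (h : IsCost φ) {x : ℝ}
    (hx : x ∈ Set.Ioo (0 : ℝ) 1) : DifferentiableAt ℝ (sideCost φ) x := by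
  have := h.thriceDiff x hx (1 / 2) half_mem 0 (by norm_num)
  rwa [iteratedDeriv_zero] at this

theorem IsCost.differentiableAt_deriv {φ : ℝ → EReal} (h : IsCost φ) {x : ℝ}
    (hx : x ∈ Set.Ioo (0 : ℝ) 1) : DifferentiableAt ℝ (deriv (sideCost φ)) x := by
  have := h.thriceDiff x hx (1 / 2) half_mem 1 (by norm_num)
  rwa [iteratedDeriv_one] at this

theorem IsCost.strictConvexOn_sideCost {φ : ℝ → EReal} (h : IsCost φ) :
    StrictConvexOn ℝ (Set.Ioo 0 1) (sideCost φ) := by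
  refine ⟨convex_Ioo 0 1, fun x hx y hy hxy a b ha hb hab => ?_⟩
  have := h.strictConvex.2 (h.effective hx half_mem) (h.effective hy half_mem)
    (fun e => hxy (congrArg Prod.fst e)) ha hb hab
  have e : a • (x, (1 / 2 : ℝ)) + b • (y, (1 / 2 : ℝ)) = (a • x + b • y, 1 / 2) := by
    ext
    · simp
    · simp only [Prod.snd_add, Prod.smul_snd, smul_eq_mul, ← add_mul, hab, one_mul]
  rw [e] at this
  exact this

theorem IsCost.strictMonoOn_margCost {φ : ℝ → EReal} (h : IsCost φ) :
    StrictMonoOn (margCost φ) (Set.Ico 0 1) := by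
  have hm : StrictMonoOn (deriv (sideCost φ)) (Set.Ioo 0 1) :=
    h.strictConvexOn_sideCost.strictMonoOn_deriv fun x hx => h.differentiableAt hx
  intro x hx y hy hxy
  exact hm ⟨by linarith [hx.1], by linarith [hx.2]⟩ ⟨by linarith [hy.1], by linarith [hy.2]⟩
    (by linarith)

theorem IsCost.margCost_pos {φ : ℝ → EReal} (h : IsCost φ) {d : ℝ} (hd : d ∈ Set.Ioo (0 : ℝ) 1) :
    0 < margCost φ d := by
  rw [← margCost_zero φ]
  exact h.strictMonoOn_margCost ⟨le_rfl, zero_lt_one⟩ ⟨hd.1.le, hd.2⟩ hd.1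

theorem IsCost.continuousOn_margCost {φ : ℝ → EReal} (h : IsCost φ) :
    ContinuousOn (margCost φ) (Set.Ico 0 1) := by
  intro d hd
  have h1 := (h.differentiableAt_deriv (x := (1 + d) / 2)
    ⟨by linarith [hd.1], by linarith [hd.2]⟩).continuousAt
  exact (ContinuousAt.comp (f := fun d : ℝ => (1 + d) / 2) h1 (by fun_prop)).continuousWithinAt

/-- The marginal cost is star-shaped, since `c_xxx ≤ 0` where `x ≤ 1/2`. -/
theorem IsCost.mul_margCost_le {φ : ℝ → EReal} (h : IsCost φ) {d d' : ℝ} (h0 : 0 ≤ d)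
    (hd : d ≤ d') (h1 : d' < 1) : d' * margCost φ d ≤ d * margCost φ d' := by
  rcases h0.eq_or_lt with rfl | hpos
  · rw [margCost_zero]; simp
  have hint : interior (Set.Ioc (0 : ℝ) (1 / 2)) = Set.Ioo 0 (1 / 2) := interior_Ioc
  have hsub : Set.Ioc (0 : ℝ) (1 / 2) ⊆ Set.Ioo 0 1 := fun x hx => ⟨hx.1, by linarith [hx.2]⟩
  have hsub' : Set.Ioo (0 : ℝ) (1 / 2) ⊆ Set.Ioo 0 1 := fun x hx => ⟨hx.1, by linarith [hx.2]⟩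
  -- A concave function vanishing at 1/2 has monotone difference quotients from that point; oddness
  -- under t ↦ 1 - t carries this over to `margCost`.
  have hc : ConcaveOn ℝ (Set.Ioc 0 (1 / 2)) (deriv (sideCost φ)) := by
    refine concaveOn_of_deriv2_nonpos (convex_Ioc 0 (1 / 2)) ?_ ?_ ?_ ?_
    · exact fun x hx => (h.differentiableAt_deriv (hsub hx)).continuousAt.continuousWithinAt
    · rw [hint]
      exact fun x hx => (h.differentiableAt_deriv (hsub' hx)).differentiableWithinAt
    · rw [hint]
      intro x hx
      have := h.thriceDiff x (hsub' hx) (1 / 2) half_mem 2 (by norm_num)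
      rw [iteratedDeriv_succ, iteratedDeriv_one] at this
      exact this.differentiableWithinAt
    · rw [hint]
      intro x hx
      have := h.third_nonpos x ⟨hx.1, hx.2.le⟩ (1 / 2) half_mem
      rw [iteratedDeriv_eq_iterate] at this
      exact this
  have hd' : 0 < d' := hpos.trans_le hd
  have m1 : (1 / 2 : ℝ) ∈ Set.Ioc (0 : ℝ) (1 / 2) := ⟨by norm_num, le_rfl⟩
  have m2 : (1 - d') / 2 ∈ Set.Ioc (0 : ℝ) (1 / 2) := ⟨by linarith, by linarith⟩
  have key := hc.2 m1 m2 (sub_nonneg.2 ((div_le_one hd').2 hd)) (by positivity : 0 ≤ d / d')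
    (by ring)
  have e : (1 - d / d') • (1 / 2 : ℝ) + (d / d') • ((1 - d') / 2) = (1 - d) / 2 := by
    simp only [smul_eq_mul]; field_simp; ring
  have e0 : deriv (sideCost φ) (1 / 2) = 0 := by
    have := margCost_zero φ
    rwa [margCost, add_zero] at this
  rw [e, e0, smul_zero, zero_add, smul_eq_mul, ← neg_neg (deriv (sideCost φ) ((1 - d') / 2)),
    ← margCost_eq_neg, ← neg_neg (deriv (sideCost φ) ((1 - d) / 2)), ← margCost_eq_neg,
    mul_neg, neg_le_neg_iff, div_mul_eq_mul_div, le_div_iff₀ hd'] at key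
  linarith

/-- The parabola has derivative (margCost l / l) d. Since margCost d / d is nondecreasing, the cost
minus the parabola falls up to d = l and rises afterwards. -/
theorem IsCost.sideCost_ge {φ : ℝ → EReal} (h : IsCost φ) {l d : ℝ} (hl : l ∈ Set.Ioo (0 : ℝ) 1)
    (hd : d ∈ Set.Ico (0 : ℝ) 1) :
    2 * sideCost φ ((1 + l) / 2) + margCost φ l / (2 * l) * (d ^ 2 - l ^ 2) ≤
      2 * sideCost φ ((1 + d) / 2) := by
  have hψ : ∀ x ∈ Set.Ico (0 : ℝ) 1, HasDerivAt
      (fun d => 2 * sideCost φ ((1 + d) / 2) - margCost φ l / (2 * l) * d ^ 2)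
      (margCost φ x - margCost φ l / l * x) x := by
    intro x hx
    have h1 := (h.differentiableAt (x := (1 + x) / 2)
      ⟨by linarith [hx.1], by linarith [hx.2]⟩).hasDerivAt
    have h2 := ((hasDerivAt_id x).const_add 1).div_const 2
    have h3 := ((h1.comp x h2).const_mul 2).sub
      (((hasDerivAt_id x).pow 2).const_mul (margCost φ l / (2 * l)))
    refine h3.congr_deriv ?_
    have := hl.1.ne'
    simp only [margCost, id]
    field_simp
    norm_num
    ring
  suffices hs : 2 * sideCost φ ((1 + l) / 2) - margCost φ l / (2 * l) * l ^ 2 ≤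
      2 * sideCost φ ((1 + d) / 2) - margCost φ l / (2 * l) * d ^ 2 by linarith
  rcases le_total d l with hdl | hdl
  · have hsub : Set.Icc 0 l ⊆ Set.Ico (0 : ℝ) 1 := fun x hx => ⟨hx.1, hx.2.trans_lt hl.2⟩
    refine antitoneOn_of_deriv_nonpos (convex_Icc 0 l)
      (fun x hx => (hψ x (hsub hx)).continuousAt.continuousWithinAt)
      (fun x hx => (hψ x (hsub (interior_subset hx))).differentiableAt.differentiableWithinAt)
      (fun x hx => ?_) ⟨hd.1, hdl⟩ ⟨hl.1.le, le_rfl⟩ hdl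
    have hx' := interior_subset hx
    rw [(hψ x (hsub hx')).deriv, sub_nonpos, div_mul_eq_mul_div, le_div_iff₀ hl.1]
    have := h.mul_margCost_le hx'.1 hx'.2 hl.2
    linarith
  · have hsub : Set.Ico l 1 ⊆ Set.Ico (0 : ℝ) 1 := fun x hx => ⟨hl.1.le.trans hx.1, hx.2⟩
    refine monotoneOn_of_deriv_nonneg (convex_Ico l 1)
      (fun x hx => (hψ x (hsub hx)).continuousAt.continuousWithinAt)
      (fun x hx => (hψ x (hsub (interior_subset hx))).differentiableAt.differentiableWithinAt)
      (fun x hx => ?_) ⟨le_rfl, hl.2⟩ ⟨hdl, hd.2⟩ hdl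
    have hx' := interior_subset hx
    rw [(hψ x (hsub hx')).deriv, sub_nonneg, div_mul_eq_mul_div, div_le_iff₀ hl.1]
    have := h.mul_margCost_le hl.1.le hx'.1 hx'.2
    linarith

theorem IsCost.toReal_cost_diag {φ : ℝ → EReal} (h : IsCost φ) {d : ℝ}
    (hd : d ∈ Set.Ico (0 : ℝ) 1) :
    (cost φ ((1 + d) / 2, (1 - d) / 2)).toReal = 2 * sideCost φ ((1 + d) / 2) := by
  have hx : (1 + d) / 2 ∈ Set.Ioo (0 : ℝ) 1 := ⟨by linarith [hd.1], by linarith [hd.2]⟩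
  have hy : (1 - d) / 2 ∈ Set.Ioo (0 : ℝ) 1 := ⟨by linarith [hd.2], by linarith [hd.1]⟩
  have := h.costReal_eq hx hy
  rw [costReal] at this
  rw [this, ← sideCost_reflect φ ((1 - d) / 2), show 1 - (1 - d) / 2 = (1 + d) / 2 by ring]
  ring

theorem IsCost.cost_ge_of_le {φ : ℝ → EReal} (h : IsCost φ) {l : ℝ} (hl : l ∈ Set.Ioo (0 : ℝ) 1)
    {q : ℝ × ℝ} (hq : q ∈ square) (ht : cost φ q ≠ ⊤) (hle : q.2 ≤ q.1) :
    2 * sideCost φ ((1 + l) / 2) + margCost φ l / (2 * l) * ((q.1 - q.2) ^ 2 - l ^ 2) ≤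
      (cost φ q).toReal := by
  obtain ⟨x, y⟩ := q
  obtain ⟨⟨hx0, hx1⟩, hy0, hy1⟩ := hq
  simp only at hx0 hx1 hy0 hy1 hle ⊢
  have hq : (x, y) ∈ {q | q ∈ square ∧ cost φ q ≠ ⊤} := ⟨⟨⟨hx0, hx1⟩, hy0, hy1⟩, ht⟩
  rcases (by linarith : x - y ≤ 1).lt_or_eq with hd | hd
  · have hdm : x - y ∈ Set.Ico (0 : ℝ) 1 := ⟨by linarith, hd⟩
    have hr : (1 - y, 1 - x) ∈ {q | q ∈ square ∧ cost φ q ≠ ⊤} :=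
      ⟨⟨⟨by simpa using hy1, by simpa using hy0⟩, by simpa using hx1, by simpa using hx0⟩,
        by rwa [cost_reflect]⟩
    -- Reflection in the antidiagonal preserves the cost and x - y, so convexity makes the
    -- antidiagonal point with the same difference no dearer.
    have hc := h.strictConvex.convexOn.2 hq hr (by norm_num : (0 : ℝ) ≤ 1 / 2)
      (by norm_num : (0 : ℝ) ≤ 1 / 2) (by norm_num)
    have e : (1 / 2 : ℝ) • (x, y) + (1 / 2 : ℝ) • (1 - y, 1 - x) =
        ((1 + (x - y)) / 2, (1 - (x - y)) / 2) := by
      ext <;> simp <;> ring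
    simp only [e, h.toReal_cost_diag hdm, cost_reflect, smul_eq_mul] at hc
    have := h.sideCost_ge hl hdm
    linarith
  · obtain rfl : x = 1 := by linarith
    obtain rfl : y = 0 := by linarith
    -- The corner has d = 1, where the derivative argument is unavailable. It is approached along
    -- the segment from the centre, where the cost is 0; convexity bounds the cost there by θ times
    -- the corner cost, and θ tends to 1.
    have hbound : ∀ θ ∈ Set.Ioo (0 : ℝ) 1, 2 * sideCost φ ((1 + l) / 2) +
        margCost φ l / (2 * l) * (θ ^ 2 - l ^ 2) ≤ θ * (cost φ (1, 0)).toReal := by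
      intro θ hθ
      have hc := h.strictConvex.convexOn.2 hq (h.effective half_mem half_mem) hθ.1.le
        (sub_nonneg.2 hθ.2.le) (by ring)
      have e : θ • ((1 : ℝ), (0 : ℝ)) + (1 - θ) • ((1 / 2 : ℝ), (1 / 2 : ℝ)) =
          ((1 + θ) / 2, (1 - θ) / 2) := by
        ext <;> simp <;> ring
      have e2 : (cost φ (1 / 2, 1 / 2)).toReal = 0 := by
        have := h.toReal_cost_diag (d := 0) ⟨le_rfl, zero_lt_one⟩
        rwa [add_zero, sub_zero, h.sideCost_half, mul_zero] at this
      simp only [e, e2, h.toReal_cost_diag ⟨hθ.1.le, hθ.2⟩, smul_eq_mul, mul_zero, add_zero] at hc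
      exact (h.sideCost_ge hl ⟨hθ.1.le, hθ.2⟩).trans hc
    have hL : Tendsto (fun θ : ℝ => 2 * sideCost φ ((1 + l) / 2) +
        margCost φ l / (2 * l) * (θ ^ 2 - l ^ 2)) (𝓝[<] 1) (𝓝 (2 * sideCost φ ((1 + l) / 2) +
        margCost φ l / (2 * l) * ((1 - 0) ^ 2 - l ^ 2))) := by
      rw [sub_zero]
      exact (Continuous.tendsto (by fun_prop) 1).mono_left nhdsWithin_le_nhds
    have hR : Tendsto (fun θ : ℝ => θ * (cost φ (1, 0)).toReal) (𝓝[<] 1)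
        (𝓝 (1 * (cost φ (1, 0)).toReal)) :=
      (Continuous.tendsto (by fun_prop) 1).mono_left nhdsWithin_le_nhds
    rw [one_mul] at hR
    refine le_of_tendsto_of_tendsto hL hR ?_
    filter_upwards [Ioo_mem_nhdsLT zero_lt_one] with θ hθ using hbound θ hθ

theorem IsCost.cost_ge {φ : ℝ → EReal} (h : IsCost φ) {l : ℝ} (hl : l ∈ Set.Ioo (0 : ℝ) 1)
    {q : ℝ × ℝ} (hq : q ∈ square) (ht : cost φ q ≠ ⊤) :
    2 * sideCost φ ((1 + l) / 2) + margCost φ l / (2 * l) * (|q.1 - q.2| ^ 2 - l ^ 2) ≤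
      (cost φ q).toReal := by
  rw [sq_abs]
  rcases le_total q.2 q.1 with hle | hle
  · exact h.cost_ge_of_le hl hq ht hle
  · have := h.cost_ge_of_le (q := q.swap) hl ⟨hq.2, hq.1⟩ (by rwa [cost_swap]) hle
    rw [cost_swap, Prod.fst_swap, Prod.snd_swap] at this
    rwa [show (q.1 - q.2) ^ 2 = (q.2 - q.1) ^ 2 by ring]

/-- Identifies the equation τ = 0 with the first-order condition at zero multiplier, `supportSlope`
= 0. -/
theorem IsCost.tau_eq {φ : ℝ → EReal} (h : IsCost φ) (κ : ℝ) {l : ℝ} (hl : l ∈ Set.Ioo (0 : ℝ) 1) :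
    tau φ κ l = 2 * (κ * margCost φ l - edge) := by
  have hx : (1 + l) / 2 ∈ Set.Ioo (0 : ℝ) 1 := ⟨by linarith [hl.1], by linarith [hl.2]⟩
  have hy : (1 - l) / 2 ∈ Set.Ioo (0 : ℝ) 1 := ⟨by linarith [hl.2], by linarith [hl.1]⟩
  have hX : costX φ ((1 - l) / 2) ((1 + l) / 2) = -margCost φ l := by
    rw [margCost_eq_neg, neg_neg, costX]
    have : (fun t => costReal φ t ((1 + l) / 2)) =ᶠ[𝓝 ((1 - l) / 2)]
        fun t => sideCost φ t + sideCost φ ((1 + l) / 2) := by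
      filter_upwards [Ioo_mem_nhds hy.1 hy.2] with t ht using h.costReal_eq ht hx
    rw [this.deriv_eq, deriv_add_const]
  have hY : costY φ ((1 - l) / 2) ((1 + l) / 2) = margCost φ l := by
    rw [margCost, costY]
    have : (fun t => costReal φ ((1 - l) / 2) t) =ᶠ[𝓝 ((1 + l) / 2)]
        fun t => sideCost φ ((1 - l) / 2) + sideCost φ t := by
      filter_upwards [Ioo_mem_nhds hx.1 hx.2] with t ht using h.costReal_eq hy ht
    rw [this.deriv_eq, deriv_const_add]
  rw [tau, hX, hY, P₁_self hl.1]
  ring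

/-! ## Fusions -/

theorem integrable_prior {E : Type*} [NormedAddCommGroup E] (ω : ℝ) (ψ : ℝ × ℝ → E) :
    Integrable ψ (prior ω) := by
  have h : ∀ (a : ℝ) (x : ℝ × ℝ), Integrable ψ (ENNReal.ofReal a • Measure.dirac x) := fun a x =>
    (integrable_dirac (by simp)).smul_measure (by simp)
  exact (((h _ _).add_measure (h _ _)).add_measure (h _ _)).add_measure (h _ _)

theorem integral_prior {ω : ℝ} (h₀ : 0 ≤ ω) (h₁ : ω ≤ 1 / 2) (ψ : ℝ × ℝ → ℝ) :
    ∫ z, ψ z ∂prior ω =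
      ω * ψ (0, 1) + ω * ψ (1, 0) + (1 / 2 - ω) * ψ (1, 1) + (1 / 2 - ω) * ψ (0, 0) := by
  have h : ∀ (a : ℝ) (x : ℝ × ℝ), Integrable ψ (ENNReal.ofReal a • Measure.dirac x) := fun a x =>
    (integrable_dirac (by simp)).smul_measure (by simp)
  rw [prior, integral_add_measure (((h _ _).add_measure (h _ _)).add_measure (h _ _)) (h _ _),
    integral_add_measure ((h _ _).add_measure (h _ _)) (h _ _),
    integral_add_measure (h _ _) (h _ _)]
  simp only [integral_smul_measure, integral_dirac, smul_eq_mul, ENNReal.toReal_ofReal h₀,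
    ENNReal.toReal_ofReal (sub_nonneg.2 h₁)]

section Fusion

variable {ω : ℝ} {F : Measure (ℝ × ℝ)}

theorem IsFusion.integrable (hF : IsFusion ω F) {ψ : ℝ × ℝ → ℝ} (hm : Measurable ψ) {M : ℝ}
    (hb : ∀ q ∈ square, |ψ q| ≤ M) : Integrable ψ F := by
  have := hF.prob
  refine Integrable.of_bound hm.aestronglyMeasurable M ?_
  filter_upwards [hF.supported] with q hq using hb q hq

theorem integral_bind_kernel {K : Kernel (ℝ × ℝ) (ℝ × ℝ)} {ψ : ℝ × ℝ → ℝ}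
    (h : Integrable ψ (F.bind K)) : ∫ z, ψ z ∂(F.bind K) = ∫ q, ∫ z, ψ z ∂(K q) ∂F := by
  rw [Measure.comp_eq_comp_const_apply] at h ⊢
  rw [Kernel.integral_comp h, Kernel.const_apply]

/-- Jensen's inequality for fusions and the three test functions that matter. -/
theorem IsFusion.moments (hF : IsFusion ω F) (h₀ : 0 ≤ ω) (h₁ : ω ≤ 1 / 2) :
    ∫ q, q.1 ∂F = 1 / 2 ∧ ∫ q, q.2 ∂F = 1 / 2 ∧ ∫ q, |q.1 - q.2| ∂F ≤ 2 * ω := by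
  have hp := hF.prob
  obtain ⟨K, hK, hbind, hmean⟩ := hF.split
  have hint : ∀ᵐ q ∂F, Integrable (fun z : ℝ × ℝ => z) (K q) :=
    Measure.ae_integrable_of_integrable_comp (by rw [hbind]; exact integrable_prior ω _)
  have hI : ∀ ψ : ℝ × ℝ → ℝ, Integrable ψ (F.bind K) := fun ψ => by
    rw [hbind]; exact integrable_prior ω ψ
  have hmean1 : ∀ᵐ q ∂F, ∫ z, z.1 ∂(K q) = q.1 := by
    filter_upwards [hint, hmean] with q hq hm
    have := (ContinuousLinearMap.fst ℝ ℝ ℝ).integral_comp_comm hq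
    rwa [hm] at this
  have hmean2 : ∀ᵐ q ∂F, ∫ z, z.2 ∂(K q) = q.2 := by
    filter_upwards [hint, hmean] with q hq hm
    have := (ContinuousLinearMap.snd ℝ ℝ ℝ).integral_comp_comm hq
    rwa [hm] at this
  refine ⟨?_, ?_, ?_⟩
  · have h := integral_bind_kernel (hI fun z => z.1)
    rw [hbind, integral_prior h₀ h₁, integral_congr_ae hmean1] at h
    rw [← h]; ring
  · have h := integral_bind_kernel (hI fun z => z.2)
    rw [hbind, integral_prior h₀ h₁, integral_congr_ae hmean2] at h
    rw [← h]; ring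
  · have h := integral_bind_kernel (hI fun z => |z.1 - z.2|)
    rw [hbind, integral_prior h₀ h₁] at h
    have h2 : ∫ q, |q.1 - q.2| ∂F ≤ ∫ q, ∫ z, |z.1 - z.2| ∂(K q) ∂F := by
      refine integral_mono_ae (hF.integrable (M := 1) (by fun_prop) fun q hq => ?_) ?_ ?_
      · rw [abs_abs, abs_le]
        exact ⟨by linarith [hq.1.1, hq.2.2], by linarith [hq.1.2, hq.2.1]⟩
      · have := Measure.integrable_integral_norm_of_integrable_comp (hI fun z => z.1 - z.2)
        simpa only [Real.norm_eq_abs] using this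
      · filter_upwards [hint, hmean1, hmean2] with q hq e1 e2
        rw [← e1, ← e2, ← integral_sub hq.fst hq.snd]
        exact abs_integral_le_integral_abs
    rw [← h] at h2
    refine h2.trans_eq ?_
    norm_num
    ring

/-- A law of the values that puts weights `a`, `b` on `(0, 1)`, `(1, 0)` and agrees with the prior
on the diagonal. -/
def signalLaw (ω a b : ℝ) : Measure (ℝ × ℝ) :=
  ENNReal.ofReal a • Measure.dirac (0, 1) + ENNReal.ofReal b • Measure.dirac (1, 0)
    + ENNReal.ofReal (1 / 2 - ω) • Measure.dirac (1, 1)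
    + ENNReal.ofReal (1 / 2 - ω) • Measure.dirac (0, 0)

theorem isProbabilityMeasure_signalLaw {a b : ℝ} (ha : 0 ≤ a) (hb : 0 ≤ b) (hab : a + b = 2 * ω)
    (h₁ : ω ≤ 1 / 2) : IsProbabilityMeasure (signalLaw ω a b) := by
  have h : 0 ≤ 1 / 2 - ω := sub_nonneg.2 h₁
  refine ⟨?_⟩
  simp only [signalLaw, Measure.add_apply, Measure.smul_apply, measure_univ, smul_eq_mul, mul_one]
  rw [← ENNReal.ofReal_add ha hb, ← ENNReal.ofReal_add (by positivity) h,
    ← ENNReal.ofReal_add (by positivity) h, ← ENNReal.ofReal_one]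
  congr 1; linarith

theorem integral_signalLaw {a b : ℝ} (ha : 0 ≤ a) (hb : 0 ≤ b) (hab : a + b = 2 * ω)
    (h₁ : ω ≤ 1 / 2) : ∫ z, z ∂signalLaw ω a b = ((1 + b - a) / 2, (1 + a - b) / 2) := by
  have h : ∀ (a : ℝ) (x : ℝ × ℝ), Integrable (fun z : ℝ × ℝ => z)
      (ENNReal.ofReal a • Measure.dirac x) := fun a x =>
    (integrable_dirac (by simp)).smul_measure (by simp)
  rw [signalLaw, integral_add_measure (((h _ _).add_measure (h _ _)).add_measure (h _ _)) (h _ _),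
    integral_add_measure ((h _ _).add_measure (h _ _)) (h _ _),
    integral_add_measure (h _ _) (h _ _)]
  simp only [integral_smul_measure, integral_dirac, ENNReal.toReal_ofReal ha,
    ENNReal.toReal_ofReal hb, ENNReal.toReal_ofReal (sub_nonneg.2 h₁)]
  ext <;> simp <;> linarith

/-- The signal is informative only about the off-diagonal states: it moves conditional mass l/2
between (0, 1) and (1, 0) and leaves the diagonal alone. The condition l ≤ 2ω keeps the weight ω -
l/2 nonnegative. -/
theorem isFusion_twoPoint {l : ℝ} (hl : l ∈ Set.Ioo (0 : ℝ) 1) (hle : l ≤ 2 * ω)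
    (h₁ : ω ≤ 1 / 2) : IsFusion ω (twoPoint l) := by
  obtain ⟨hl0, hl1⟩ := hl
  have hω : 0 ≤ ω := by linarith
  have ha : 0 ≤ ω + l / 2 := by linarith
  have hb : 0 ≤ ω - l / 2 := by linarith
  have p1 := isProbabilityMeasure_signalLaw (ω := ω) ha hb (by ring) h₁
  have p2 := isProbabilityMeasure_signalLaw (ω := ω) hb ha (by ring) h₁
  refine ⟨inferInstance, ?_, ?_⟩
  · rw [twoPoint, ae_add_measure_iff]
    constructor <;> refine Measure.ae_smul_measure ?_ _ <;> rw [ae_dirac_eq] <;>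
      exact ⟨⟨by simp only; linarith, by simp only; linarith⟩,
        ⟨by simp only; linarith, by simp only; linarith⟩⟩
  · classical
    have hs : MeasurableSet {q : ℝ × ℝ | q.1 < q.2} :=
      measurableSet_lt measurable_fst measurable_snd
    have m1 : ((1 - l) / 2, (1 + l) / 2) ∈ {q : ℝ × ℝ | q.1 < q.2} := by
      show (1 - l) / 2 < (1 + l) / 2; linarith
    have m2 : ((1 + l) / 2, (1 - l) / 2) ∉ {q : ℝ × ℝ | q.1 < q.2} := by
      show ¬ (1 + l) / 2 < (1 - l) / 2; linarith
    refine ⟨Kernel.piecewise hs (Kernel.const _ (signalLaw ω (ω + l / 2) (ω - l / 2)))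
      (Kernel.const _ (signalLaw ω (ω - l / 2) (ω + l / 2))), inferInstance, ?_, ?_⟩
    · have hadd : signalLaw ω (ω + l / 2) (ω - l / 2) + signalLaw ω (ω - l / 2) (ω + l / 2) =
          (2 : ENNReal) • prior ω := by
        have e : ENNReal.ofReal (ω + l / 2) + ENNReal.ofReal (ω - l / 2) =
            2 * ENNReal.ofReal ω := by
          rw [← ENNReal.ofReal_add ha hb, ← ENNReal.ofReal_ofNat 2,
            ← ENNReal.ofReal_mul (by norm_num)]
          congr 1; ring
        simp only [signalLaw, prior, smul_add, smul_smul]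
        rw [← e, two_mul]
        simp only [add_smul]
        abel
      rw [twoPoint, Measure.comp_add, Measure.comp_smul, Measure.comp_smul,
        Measure.dirac_bind (Kernel.measurable _), Measure.dirac_bind (Kernel.measurable _),
        Kernel.piecewise_apply, Kernel.piecewise_apply, if_pos m1, if_neg m2, Kernel.const_apply,
        Kernel.const_apply, ← smul_add, hadd, smul_smul, ENNReal.inv_mul_cancel (by simp) (by simp),
        one_smul]
    · rw [twoPoint, ae_add_measure_iff]
      constructor <;> refine Measure.ae_smul_measure ?_ _ <;> rw [ae_dirac_eq]
      · show ∫ z, z ∂(Kernel.piecewise hs _ _ _) = _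
        rw [Kernel.piecewise_apply, if_pos m1, Kernel.const_apply,
          integral_signalLaw ha hb (by ring) h₁]
        ext <;> simp <;> ring
      · show ∫ z, z ∂(Kernel.piecewise hs _ _ _) = _
        rw [Kernel.piecewise_apply, if_neg m2, Kernel.const_apply,
          integral_signalLaw hb ha (by ring) h₁]
        ext <;> simp <;> ring

end Fusion

/-! ## The consumer -/

theorem buysFirst_offer (tie : ℝ × ℝ → ℝ × ℝ → ℝ) (q p : ℝ × ℝ) :
    buysFirst tie q p * (q.1 - p.1) + (1 - buysFirst tie q p) * (q.2 - p.2) =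
      max (q.1 - p.1) (q.2 - p.2) := by
  unfold buysFirst
  split_ifs with h h'
  · rw [max_eq_left h.le]; ring
  · rw [max_eq_right h'.le]; ring
  · rw [le_antisymm (not_lt.1 h) (not_lt.1 h'), max_self]; ring

/-- The consumer's expected utility at the posterior mean `q`. -/
def offer (l : ℝ) (q : ℝ × ℝ) : ℝ :=
  ∫ p, max (q.1 - p.1) (q.2 - p.2) ∂((priceLaw l).prod (priceLaw l))

theorem utility_eq_offer (tie : ℝ × ℝ → ℝ × ℝ → ℝ) (l : ℝ) :
    utility tie (priceLaw l) (priceLaw l) = offer l := by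
  funext q
  simp only [utility, offer, buysFirst_offer]

def meanPrice (l : ℝ) : ℝ := ∫ p, p ∂priceLaw l

theorem integrable_offer {l : ℝ} (hl : 0 < l) (q : ℝ × ℝ) :
    Integrable (fun p : ℝ × ℝ => max (q.1 - p.1) (q.2 - p.2))
      ((priceLaw l).prod (priceLaw l)) := by
  have h1 := integrable_priceLaw hl (ψ := fun p => q.1 - p) (by fun_prop)
  have h2 := integrable_priceLaw hl (ψ := fun p => q.2 - p) (by fun_prop)
  exact (h1.comp_fst (priceLaw l)).sup (h2.comp_snd (priceLaw l))

theorem offer_swap (l : ℝ) (q : ℝ × ℝ) : offer l q.swap = offer l q := by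
  rw [offer, offer, ← integral_prod_swap]
  simp only [Prod.fst_swap, Prod.snd_swap, max_comm]

/-- From max(a, b) = b + (a - b)⁺, integrated first over p₁ and then over p₂. -/
theorem offer_eq {l : ℝ} (hl : 0 < l) (q : ℝ × ℝ) :
    offer l q = q.2 - meanPrice l + l * gain ((q.1 - q.2) / l) := by
  have hin : ∀ p₂ : ℝ, ∫ p₁, max (q.1 - p₁) (q.2 - p₂) ∂priceLaw l =
      (q.2 - p₂) + l * cumCDF ((p₂ + (q.1 - q.2)) / l) := by
    intro p₂
    have e : ∀ p₁, max (q.1 - p₁) (q.2 - p₂) =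
        (q.2 - p₂) + max ((p₂ + (q.1 - q.2)) - p₁) 0 := fun p₁ => by
      rw [← max_add_add_left, add_zero]; congr 1; ring
    simp only [e]
    rw [integral_add (integrable_const _) (integrable_priceLaw hl (by fun_prop)),
      integral_const, probReal_univ, one_smul, integral_priceLaw hl,
      ← integral_posPart_unitPrice, ← integral_const_mul]
    congr 1
    refine integral_congr_ae (ae_of_all _ fun p => ?_)
    simp only
    rw [mul_max_of_nonneg _ _ hl.le, mul_zero, mul_sub, mul_div_cancel₀ _ hl.ne']
  have hc := continuous_cumCDF
  rw [offer, integral_prod_symm _ (integrable_offer hl q)]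
  simp only [hin]
  rw [integral_add (integrable_priceLaw hl (by fun_prop)) (integrable_priceLaw hl (by fun_prop)),
    integral_sub (integrable_const _) (integrable_priceLaw hl (by fun_prop)), integral_const,
    probReal_univ, one_smul, integral_const_mul, ← meanPrice, integral_priceLaw hl,
    ← integral_cumCDF_unitPrice]
  simp only [add_div, mul_div_cancel_left₀ _ hl.ne']

theorem offer_eq_abs {l : ℝ} (hl : 0 < l) (q : ℝ × ℝ) : offer l q =
    (q.1 + q.2) / 2 - |q.1 - q.2| / 2 - meanPrice l + l * gain (|q.1 - q.2| / l) := by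
  rcases le_total q.2 q.1 with h | h
  · rw [abs_of_nonneg (sub_nonneg.2 h), offer_eq hl]; ring
  · rw [abs_of_nonpos (sub_nonpos.2 h), ← offer_swap, offer_eq hl, neg_sub, Prod.fst_swap,
      Prod.snd_swap]; ring

theorem measurable_offer (l : ℝ) : Measurable (offer l) := by
  have h : StronglyMeasurable fun s : (ℝ × ℝ) × (ℝ × ℝ) =>
      max (s.1.1 - s.2.1) (s.1.2 - s.2.2) := by
    refine Measurable.stronglyMeasurable ?_
    fun_prop
  exact (StronglyMeasurable.integral_prod_right' (ν := (priceLaw l).prod (priceLaw l)) h).measurable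

theorem abs_offer_le {l : ℝ} (hl : 0 < l) {q : ℝ × ℝ} (hq : q ∈ square) :
    |offer l q| ≤ ∫ p, (1 + |p.1| + |p.2|) ∂((priceLaw l).prod (priceLaw l)) := by
  have h1 := (integrable_priceLaw hl (ψ := fun p => |p|) (by fun_prop)).comp_fst (priceLaw l)
  have h2 := (integrable_priceLaw hl (ψ := fun p => |p|) (by fun_prop)).comp_snd (priceLaw l)
  rw [offer, ← Real.norm_eq_abs]
  refine norm_integral_le_of_norm_le (((integrable_const 1).add h1).add h2)
    (ae_of_all _ fun p => ?_)
  rw [Real.norm_eq_abs, abs_le]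
  have a1 := abs_le.1 (le_refl |p.1|)
  have a2 := abs_le.1 (le_refl |p.2|)
  have b1 := abs_nonneg p.1
  have b2 := abs_nonneg p.2
  obtain ⟨⟨x0, x1⟩, y0, y1⟩ := hq
  exact ⟨le_max_of_le_left (by linarith), max_le (by linarith) (by linarith)⟩

/-- The slope in `|x - y|` of the price function that supports the consumer's optimum. -/
def supportSlope (φ : ℝ → EReal) (κ l : ℝ) : ℝ := edge - κ * margCost φ l

/-- The constant of the price function that supports the consumer's optimum. -/
def supportConst (φ : ℝ → EReal) (κ l : ℝ) : ℝ :=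
  offer l ((1 + l) / 2, (1 - l) / 2) - 1 / 2 - supportSlope φ κ l * l
    - κ * (2 * sideCost φ ((1 + l) / 2))

theorem offer_diag {l : ℝ} (hl : 0 < l) : offer l ((1 + l) / 2, (1 - l) / 2) =
    1 / 2 - l / 2 - meanPrice l + l * gain 1 := by
  have h : (1 + l) / 2 - (1 - l) / 2 = l := by ring
  rw [offer_eq hl]
  simp only [h, div_self hl.ne']
  ring

/-- After the bounds on `gain` and on the cost, the two sides agree to first order at t = 1; what
remains is l (t - 1)²/2 times the nonnegative difference of curvatures in `hs`. -/
theorem IsCost.offer_sub_le {φ : ℝ → EReal} (h : IsCost φ) {κ l : ℝ} (hκ : 0 < κ)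
    (hl : l ∈ Set.Ioo (0 : ℝ) 1) (hlow : edge - edgeSlack ≤ κ * margCost φ l) {q : ℝ × ℝ}
    (hq : q ∈ square) (ht : cost φ q ≠ ⊤) :
    offer l q - ((q.1 + q.2) / 2 + supportSlope φ κ l * |q.1 - q.2| + supportConst φ κ l) ≤
      κ * (cost φ q).toReal := by
  have hc := mul_le_mul_of_nonneg_left (h.cost_ge hl hq ht) hκ.le
  have hl0 := hl.1
  set d := |q.1 - q.2| with hd
  have hg := mul_le_mul_of_nonneg_left (gain_le (t := d / l) (by positivity)) hl0.le
  rw [supportConst, offer_diag hl0, offer_eq_abs hl0, ← hd, supportSlope]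
  set t := d / l with ht'
  have hdt : d = l * t := by rw [ht']; field_simp
  have e : κ * (2 * sideCost φ ((1 + l) / 2) + margCost φ l / (2 * l) * (d ^ 2 - l ^ 2)) =
      κ * (2 * sideCost φ ((1 + l) / 2)) + κ * margCost φ l * (l * (t ^ 2 - 1) / 2) := by
    rw [hdt]; field_simp
  rw [e] at hc
  have hs : 0 ≤ (κ * margCost φ l - (edge - edgeSlack)) * (l * ((t - 1) ^ 2 / 2)) :=
    mul_nonneg (sub_nonneg.2 hlow) (by positivity)
  rw [hdt]
  linarith

/-- Lets the real-valued bound be compared with the lower integral of the cost without any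
measurability or integrability of the cost. -/
theorem ofReal_integral_le_lintegral {α : Type*} [MeasurableSpace α] {μ : Measure α} {f : α → ℝ}
    (hf : Integrable f μ) : ENNReal.ofReal (∫ x, f x ∂μ) ≤ ∫⁻ x, ENNReal.ofReal (f x) ∂μ := by
  rw [integral_eq_lintegral_pos_part_sub_lintegral_neg_part hf]
  refine (ENNReal.ofReal_le_ofReal (sub_le_self _ ENNReal.toReal_nonneg)).trans ?_
  exact ENNReal.ofReal_toReal_le

theorem consumerPayoff_eq {tie : ℝ × ℝ → ℝ × ℝ → ℝ} {φ : ℝ → EReal} {κ l : ℝ}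
    {F : Measure (ℝ × ℝ)} {C : ℝ} (hC : 0 ≤ C)
    (h : ∫⁻ q, (cost φ q).toENNReal ∂F = ENNReal.ofReal C) :
    consumerPayoff tie φ κ F (priceLaw l) (priceLaw l) =
      ((∫ q, offer l q ∂F - κ * C : ℝ) : EReal) := by
  rw [consumerPayoff, h, utility_eq_offer, EReal.coe_ennreal_ofReal, max_eq_left hC,
    EReal.coe_sub, EReal.coe_mul]

/-- Weak duality: the supporting function is integrated against F; `hup` makes the multiplier on E|x
- y| ≤ 2ω nonnegative. A fusion of infinite cost has payoff `⊥`. -/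
theorem IsCost.consumerPayoff_le {φ : ℝ → EReal} (h : IsCost φ) {ω κ l : ℝ}
    (tie : ℝ × ℝ → ℝ × ℝ → ℝ) (h₀ : 0 ≤ ω) (h₁ : ω ≤ 1 / 2)
    (hκ : 0 < κ) (hl : l ∈ Set.Ioo (0 : ℝ) 1) (hlow : edge - edgeSlack ≤ κ * margCost φ l)
    (hup : κ * margCost φ l ≤ edge) {F : Measure (ℝ × ℝ)} (hF : IsFusion ω F) :
    consumerPayoff tie φ κ F (priceLaw l) (priceLaw l) ≤
      ((1 / 2 + supportSlope φ κ l * (2 * ω) + supportConst φ κ l : ℝ) : EReal) := by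
  have hp := hF.prob
  by_cases hC : ∫⁻ q, (cost φ q).toENNReal ∂F = ⊤
  · rw [consumerPayoff, hC, EReal.coe_ennreal_top, EReal.coe_mul_top_of_pos hκ, EReal.sub_top]
    exact bot_le
  rw [consumerPayoff_eq ENNReal.toReal_nonneg (ENNReal.ofReal_toReal hC).symm, EReal.coe_le_coe_iff]
  have hs : 0 ≤ supportSlope φ κ l := sub_nonneg.2 hup
  obtain ⟨m1, m2, m3⟩ := hF.moments h₀ h₁
  have i0 := hF.integrable (measurable_offer l) fun q hq => abs_offer_le hl.1 hq
  have i1 : Integrable (fun q : ℝ × ℝ => q.1) F := hF.integrable (M := 1) (by fun_prop)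
    fun q hq => by rw [abs_of_nonneg hq.1.1]; exact hq.1.2
  have i2 : Integrable (fun q : ℝ × ℝ => q.2) F := hF.integrable (M := 1) (by fun_prop)
    fun q hq => by rw [abs_of_nonneg hq.2.1]; exact hq.2.2
  have i3 : Integrable (fun q : ℝ × ℝ => |q.1 - q.2|) F := (i1.sub i2).abs
  have i12 : Integrable (fun q : ℝ × ℝ => (q.1 + q.2) / 2) F := (i1.add i2).div_const 2
  have i3' := i3.const_mul (supportSlope φ κ l)
  have i4 : Integrable (fun q : ℝ × ℝ => (q.1 + q.2) / 2 + supportSlope φ κ l * |q.1 - q.2|) F :=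
    i12.add i3'
  have i5 : Integrable (fun q : ℝ × ℝ => (q.1 + q.2) / 2 + supportSlope φ κ l * |q.1 - q.2| +
    supportConst φ κ l) F := i4.add (integrable_const _)
  have hmain : ENNReal.ofReal (∫ q, (offer l q - ((q.1 + q.2) / 2 +
      supportSlope φ κ l * |q.1 - q.2| + supportConst φ κ l)) ∂F) ≤
      ENNReal.ofReal (κ * (∫⁻ q, (cost φ q).toENNReal ∂F).toReal) := by
    rw [ENNReal.ofReal_mul hκ.le, ENNReal.ofReal_toReal hC,
      ← lintegral_const_mul' _ _ ENNReal.ofReal_ne_top]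
    refine (ofReal_integral_le_lintegral (i0.sub i5)).trans (lintegral_mono_ae ?_)
    filter_upwards [hF.supported] with q hq
    by_cases ht : cost φ q = ⊤
    · rw [ht, EReal.toENNReal_top, ENNReal.mul_top (by simpa using hκ)]
      exact le_top
    · rw [EReal.toENNReal_of_ne_top ht, ← ENNReal.ofReal_mul hκ.le]
      exact ENNReal.ofReal_le_ofReal (h.offer_sub_le hκ hl hlow hq ht)
  rw [ENNReal.ofReal_le_ofReal_iff (by positivity), integral_sub i0 i5,
    integral_add i4 (integrable_const _), integral_add i12 i3', integral_div, integral_add i1 i2,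
    integral_const_mul, m1, m2, integral_const, probReal_univ, one_smul] at hmain
  have := mul_le_mul_of_nonneg_left m3 hs
  linarith

theorem IsCost.consumerPayoff_twoPoint {φ : ℝ → EReal} (h : IsCost φ) {κ l : ℝ}
    (tie : ℝ × ℝ → ℝ × ℝ → ℝ) (hl : l ∈ Set.Ioo (0 : ℝ) 1) :
    consumerPayoff tie φ κ (twoPoint l) (priceLaw l) (priceLaw l) =
      ((1 / 2 + supportSlope φ κ l * l + supportConst φ κ l : ℝ) : EReal) := by
  have hx : (1 + l) / 2 ∈ Set.Ioo (0 : ℝ) 1 := ⟨by linarith [hl.1], by linarith [hl.2]⟩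
  have hy : (1 - l) / 2 ∈ Set.Ioo (0 : ℝ) 1 := ⟨by linarith [hl.2], by linarith [hl.1]⟩
  have hd := h.toReal_cost_diag ⟨hl.1.le, hl.2⟩
  have hC : 0 ≤ 2 * sideCost φ ((1 + l) / 2) := by
    rw [← hd]; exact EReal.toReal_nonneg (h.nonneg (h.effective hx hy).1)
  have hc : (cost φ ((1 + l) / 2, (1 - l) / 2)).toENNReal =
      ENNReal.ofReal (2 * sideCost φ ((1 + l) / 2)) := by
    rw [EReal.toENNReal_of_ne_top (h.effective hx hy).2, hd]
  have hc' : (cost φ ((1 - l) / 2, (1 + l) / 2)).toENNReal =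
      ENNReal.ofReal (2 * sideCost φ ((1 + l) / 2)) := by
    rw [← hc, ← cost_swap, Prod.swap_prod_mk]
  rw [consumerPayoff_eq hC, integral_twoPoint, EReal.coe_eq_coe_iff, supportConst,
    ← offer_swap l ((1 - l) / 2, (1 + l) / 2), Prod.swap_prod_mk]
  · ring
  · rw [twoPoint, lintegral_add_measure, lintegral_smul_measure, lintegral_smul_measure,
      lintegral_dirac, lintegral_dirac, hc, hc', ← smul_add, ← two_mul, smul_eq_mul, ← mul_assoc,
      ENNReal.inv_mul_cancel (by simp) (by simp), one_mul]

/-- `hslack` is complementary slackness: either the multiplier vanishes or the two-point fusion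
exhausts E|x - y| ≤ 2ω, so the dual bound is attained. -/
theorem IsCost.isEquilibrium {φ : ℝ → EReal} (h : IsCost φ) {ω κ l : ℝ} (h₁ : ω ≤ 1 / 2)
    (hκ : 0 < κ) (hl : l ∈ Set.Ioo (0 : ℝ) 1) (hle : l ≤ 2 * ω)
    (hlow : edge - edgeSlack ≤ κ * margCost φ l) (hup : κ * margCost φ l ≤ edge)
    (hslack : κ * margCost φ l = edge ∨ l = 2 * ω) {tie : ℝ × ℝ → ℝ × ℝ → ℝ}
    (ht : IsTieRule tie) : IsEquilibrium tie φ ω κ (twoPoint l) (priceLaw l) (priceLaw l) := by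
  have := nullSingletonClass_priceLaw hl.1
  have hi : Integrable (fun p : ℝ => p) (priceLaw l) := integrable_priceLaw hl.1 continuous_id
  have hdirac : ∀ p : ℝ, Integrable (fun p : ℝ => p) (Measure.dirac p) := fun p =>
    integrable_dirac (by simp)
  refine ⟨inferInstance, inferInstance, hi, hi, isFusion_twoPoint hl hle h₁, fun F' hF' => ?_,
    fun p => ?_, fun p => ?_⟩
  · refine (h.consumerPayoff_le tie (by linarith [hl.1]) h₁ hκ hl hlow hup hF').trans_eq ?_
    rw [h.consumerPayoff_twoPoint tie hl]
    rcases hslack with hs | hs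
    · rw [supportSlope, hs, sub_self, zero_mul, zero_mul]
    · rw [← hs]
  · rw [profitOne_twoPoint ht (hdirac p), profitOne_twoPoint ht hi]
    exact integral_revenue_le hl.1 p
  · rw [profitTwo_twoPoint ht (hdirac p), profitTwo_twoPoint ht hi]
    exact integral_revenue_le hl.1 p

/-- Above the threshold the first-order condition has a solution that is a feasible experiment. -/
theorem IsCost.exists_margCost_eq {φ : ℝ → EReal} (h : IsCost φ) {κ b : ℝ}
    (hb : b ∈ Set.Ioo (0 : ℝ) 1) (hle : edge ≤ κ * margCost φ b) :
    ∃ l ∈ Set.Ioc (0 : ℝ) b, κ * margCost φ l = edge := by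
  have hedge : 0 < edge := edgeSlack_pos.trans edgeSlack_lt_edge
  have hc : ContinuousOn (fun d => κ * margCost φ d) (Set.Icc 0 b) :=
    continuousOn_const.mul (h.continuousOn_margCost.mono fun x hx => ⟨hx.1, hx.2.trans_lt hb.2⟩)
  obtain ⟨l, hl, he⟩ := intermediate_value_Icc hb.1.le hc
    (show edge ∈ Set.Icc (κ * margCost φ 0) (κ * margCost φ b) from
      ⟨by rw [margCost_zero, mul_zero]; exact hedge.le, hle⟩)
  refine ⟨l, ⟨hl.1.lt_of_ne ?_, hl.2⟩, he⟩
  rintro rfl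
  simp only [margCost_zero, mul_zero] at he
  exact hedge.ne he

end ComparisonShopping

end

/-! ### The thresholds and the selection of the equilibrium -/

theorem mainTheorem4 (φ : ℝ → EReal) (hφ : IsCost φ) (ω : ℝ) (hω₀ : 0 < ω) (hω : ω ≤ 2 / 5) :
    ∃ (κlow κbar : ℝ) (lam : ℝ → ℝ), 0 < κlow ∧ κlow < κbar ∧
      (∀ κ, κlow ≤ κ → lam κ ∈ Set.Ioo (0 : ℝ) 1 ∧
        ∃ G : MeasureTheory.Measure ℝ, MeasureTheory.IsProbabilityMeasure G ∧
          (∀ p, ProbabilityTheory.cdf G p = priceCDF (lam κ) p) ∧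
          ∀ tie, IsTieRule tie → IsEquilibrium tie φ ω κ (twoPoint (lam κ)) G G) ∧
      (∀ κ, κbar ≤ κ → ∀ l ∈ Set.Ioo (0 : ℝ) 1, tau φ κ l = 0 ↔ l = lam κ) ∧
      StrictAntiOn lam (Set.Ici κbar) ∧
      (∀ κ ∈ Set.Icc κlow κbar, lam κ = 2 * ω) := by
  classical
  have hb : 2 * ω ∈ Set.Ioo (0 : ℝ) 1 := ⟨by linarith, by linarith⟩
  have hmb := hφ.margCost_pos hb
  have hs := edgeSlack_pos
  have hse := edgeSlack_lt_edge
  have hedge : 0 < edge := hs.trans hse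
  -- At l = 2ω the two inequalities edge - edgeSlack ≤ κ margCost l ≤ edge hold exactly for κ
  -- between these two values.
  set κbar := edge / margCost φ (2 * ω) with hκbar
  set κlow := (edge - edgeSlack) / margCost φ (2 * ω) with hκlow
  have hlow0 : 0 < κlow := div_pos (sub_pos.2 hse) hmb
  have hlb : κlow < κbar := div_lt_div_of_pos_right (by linarith) hmb
  have hbar : κbar * margCost φ (2 * ω) = edge := div_mul_cancel₀ _ hmb.ne'
  have hlow : κlow * margCost φ (2 * ω) = edge - edgeSlack := div_mul_cancel₀ _ hmb.ne'
  have hex : ∀ κ, κbar ≤ κ → ∃ l ∈ Set.Ioc (0 : ℝ) (2 * ω), κ * margCost φ l = edge := by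
    intro κ hκ
    refine hφ.exists_margCost_eq hb ?_
    rw [← hbar]
    exact mul_le_mul_of_nonneg_right hκ hmb.le
  choose! f hf hfeq using hex
  have hIoo : ∀ κ, κbar ≤ κ → f κ ∈ Set.Ioo (0 : ℝ) 1 := fun κ hκ =>
    ⟨(hf κ hκ).1, (hf κ hκ).2.trans_lt hb.2⟩
  have hIco : ∀ {x : ℝ}, x ∈ Set.Ioo (0 : ℝ) 1 → x ∈ Set.Ico (0 : ℝ) 1 := fun hx => ⟨hx.1.le, hx.2⟩
  have huniq : ∀ κ, κbar ≤ κ → ∀ l ∈ Set.Ioo (0 : ℝ) 1, κ * margCost φ l = edge → l = f κ := by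
    intro κ hκ l hl he
    refine hφ.strictMonoOn_margCost.injOn (hIco hl) (hIco (hIoo κ hκ)) ?_
    have hpos : 0 < κ := hlow0.trans (hlb.trans_le hκ)
    exact mul_left_cancel₀ hpos.ne' (he.trans (hfeq κ hκ).symm)
  have hfbar : f κbar = 2 * ω := (huniq κbar le_rfl _ hb hbar).symm
  -- The two branches agree at κbar by `hfbar`, which is why the closed interval in the last claim
  -- is allowed.
  set lam : ℝ → ℝ := fun κ => if κbar ≤ κ then f κ else 2 * ω with hlam
  have hlam1 : ∀ κ, κbar ≤ κ → lam κ = f κ := fun κ hκ => if_pos hκ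
  have hlam2 : ∀ κ, κ ≤ κbar → lam κ = 2 * ω := by
    intro κ hκ
    rcases hκ.lt_or_eq with h | h
    · exact if_neg (not_le.2 h)
    · rw [hlam1 κ h.ge, h, hfbar]
  refine ⟨κlow, κbar, lam, hlow0, hlb, fun κ hκ => ?_, fun κ hκ l hl => ?_, ?_,
    fun κ hκ => hlam2 κ hκ.2⟩
  · have hpos : 0 < κ := hlow0.trans_le hκ
    rcases le_total κbar κ with h | h
    · rw [hlam1 κ h]
      have hl := hIoo κ h
      refine ⟨hl, priceLaw (f κ), inferInstance, cdf_priceLaw hl.1, fun tie ht => ?_⟩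
      exact hφ.isEquilibrium (by linarith) hpos hl (hf κ h).2 (by rw [hfeq κ h]; linarith)
        (hfeq κ h).le (Or.inl (hfeq κ h)) ht
    · rw [hlam2 κ h]
      refine ⟨hb, priceLaw (2 * ω), inferInstance, cdf_priceLaw hb.1, fun tie ht => ?_⟩
      refine hφ.isEquilibrium (by linarith) hpos hb le_rfl ?_ ?_ (Or.inr rfl) ht
      · rw [← hlow]; exact mul_le_mul_of_nonneg_right hκ hmb.le
      · rw [← hbar]; exact mul_le_mul_of_nonneg_right h hmb.le
  · rw [hφ.tau_eq κ hl, hlam1 κ hκ]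
    constructor
    · intro he
      exact huniq κ hκ l hl (by linarith)
    · rintro rfl
      rw [hfeq κ hκ, sub_self, mul_zero]
  · intro κ₁ h₁ κ₂ h₂ hlt
    rw [hlam1 κ₁ h₁, hlam1 κ₂ h₂]
    -- The product κ margCost l is pinned at `edge` > 0, and margCost increases in l, so a larger κ
    -- forces a smaller l.
    by_contra hcon
    have hle := hφ.strictMonoOn_margCost.monotoneOn (hIco (hIoo κ₁ h₁)) (hIco (hIoo κ₂ h₂))
      (not_lt.1 hcon)
    have hpos : 0 < κ₁ := hlow0.trans (hlb.trans_le h₁)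
    have e1 := hfeq κ₁ h₁
    have e2 := hfeq κ₂ h₂
    have m1 := hφ.margCost_pos (hIoo κ₁ h₁)
    nlinarith
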